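/- Let $G_1$ and $G_2$ be compact (Hausdorff) abelian groups with dual groups $\Gamma_1,\Gamma_2$, and let $G=G_1\times G_2$, whose dual group is identified with $\Gamma_1\times\Gamma_2$ via $(\gamma_1,\gamma_2)\mapsto\gamma_1\otimes\gamma_2$, where $(\gamma_1\otimes\gamma_2)(x,y)=\gamma_1(x)\gamma_2(y)$. Let $\Lambda\subset\Gamma_1\times\Gamma_2$ and let $p:\Gamma_1\times\Gamma_2\to\Gamma_1$ be the projection. If $L^1_\Lambda(G)$ is a rich subspace of $L^1(G)$, then $L^1_{p[\Lambda]}(G_1)$ is a rich subspace of $L^1(G_1)$ when $G_1$ is infinite, and $p[\Lambda]=\Gamma_1$ when $G_1$ is finite. Here, for a compact abelian group $H$ with dual group $\Gamma$ (the continuous homomorphisms from $H$ into the circle group) and normalized Haar measure $m$ on the Borel sets, $L^1(H)$ is the complex space $L^1(H,m)$, and for $\Theta\subset\Gamma$ $$L^1_\Theta(H)=\{f\in L^1(H): \hat f(\gamma)=0 \text{ for all } \gamma\in\Gamma\setminus\Theta\},\qquad \hat f(\gamma)=\int_H\overline{\gamma}\,f\,dm .$$ A Banach space $X$ has the Daugavet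 property if $\|\mathrm{Id}+T\|=1+\|T\|$ for every bounded operator $T:X\to X$ of rank one. A closed subspace $Y$ of $X$ is rich if $X$ has the Daugavet property and the quotient map $\pi:X\to X/Y$ is narrow, i.e., for all $x,y\in X$ with $\|x\|=\|y\|=1$, all $x^*\in X^*$ and all $\varepsilon>0$ there is $z\in X$ with $\|z\|=1$, $\|\pi(y-z)\|+|x^*(y-z)|\le\varepsilon$ and $\|x+z\|\ge 2-\varepsilon$. -/

import Mathlib

open MeasureTheory
open scoped ComplexConjugate

noncomputable section

section Daugavet

variable (𝕜 : Type*) [RCLike 𝕜]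

/-- `X` has the Daugavet property: `‖Id + T‖ = 1 + ‖T‖` for all bounded operators `T : X → X`
of rank one. -/
def DaugavetProperty (X : Type*) [NormedAddCommGroup X] [NormedSpace 𝕜 X] : Prop :=
  ∀ T : X →L[𝕜] X, Module.finrank 𝕜 (LinearMap.range (T : X →ₗ[𝕜] X)) = 1 →
    ‖ContinuousLinearMap.id 𝕜 X + T‖ = 1 + ‖T‖

variable {𝕜} {X E : Type*} [NormedAddCommGroup X] [NormedSpace 𝕜 X]
  [NormedAddCommGroup E] [NormedSpace 𝕜 E]

/-- Narrow operators on a Banach space with the Daugavet property. -/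
def IsNarrow (T : X →L[𝕜] E) : Prop :=
  DaugavetProperty 𝕜 X ∧
    ∀ x y : X, ‖x‖ = 1 → ‖y‖ = 1 → ∀ φ : X →L[𝕜] 𝕜, ∀ ε : ℝ, 0 < ε →
      ∃ z : X, ‖z‖ = 1 ∧ ‖T (y - z)‖ + ‖φ (y - z)‖ ≤ ε ∧ 2 - ε ≤ ‖x + z‖

/-- A closed subspace `Y` of `X` is rich if the quotient map `X → X ⧸ Y` is narrow. -/
def IsRich (Y : Submodule 𝕜 X) [IsClosed (Y : Set X)] : Prop :=
  IsNarrow Y.mkQL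

end Daugavet

section CompactGroup

variable (G : Type*) [CommGroup G] [TopologicalSpace G] [IsTopologicalGroup G] [CompactSpace G]

/-- The normalized Haar measure of a compact group, on its Borel `σ`-algebra. The `σ`-algebra
is written out because on a product of groups the default one is the product `σ`-algebra,
which can be smaller than the Borel `σ`-algebra. -/
def haarProb : @Measure G (borel G) :=
  letI : MeasurableSpace G := borel G
  haveI : BorelSpace G := ⟨rfl⟩
  Measure.haarMeasure ⊤

instance haarProb.isProbabilityMeasure :
    @IsProbabilityMeasure G (borel G) (haarProb G) := by
  let : MeasurableSpace G := borel G
  have : BorelSpace G := ⟨rfl⟩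
  refine ⟨?_⟩
  have h := Measure.haarMeasure_self (K₀ := (⊤ : TopologicalSpace.PositiveCompacts G))
  simpa [haarProb] using h

/-- The complex Banach space `L¹(G)`. -/
abbrev L1 : Type _ := @Lp G ℂ (borel G) _ 1 (haarProb G)

variable {G}

/-- The Fourier coefficient of `f` at the character `γ`, the integral of `conj γ * f`. -/
def fourierCoeffL1 (f : L1 G) (γ : PontryaginDual G) : ℂ :=
  letI : MeasurableSpace G := borel G
  ∫ x, conj (γ x : ℂ) * f x ∂(haarProb G)

/-- The spectrum of `f`: the set of characters with nonzero Fourier coefficient. -/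
def spec (f : L1 G) : Set (PontryaginDual G) :=
  {γ | fourierCoeffL1 f γ ≠ 0}

theorem integrable_conj_mul (f : L1 G) (γ : PontryaginDual G) :
    letI : MeasurableSpace G := borel G
    Integrable (fun x => conj (γ x : ℂ) * f x) (haarProb G) := by
  let : MeasurableSpace G := borel G
  have : BorelSpace G := ⟨rfl⟩
  have hc : Continuous fun x : G => conj (γ x : ℂ) :=
    Complex.continuous_conj.comp (continuous_subtype_val.comp (map_continuous γ))
  refine (L1.integrable_coeFn f).bdd_mul (c := 1) ?_ ?_
  · exact (hc.measurable).aestronglyMeasurable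
  · exact Filter.Eventually.of_forall fun x => by
      rw [RCLike.norm_conj, Circle.norm_coe]

theorem fourierCoeffL1_zero (γ : PontryaginDual G) : fourierCoeffL1 (0 : L1 G) γ = 0 := by
  let : MeasurableSpace G := borel G
  unfold fourierCoeffL1
  refine integral_eq_zero_of_ae ?_
  filter_upwards [Lp.coeFn_zero ℂ 1 (haarProb G)] with x hx
  rw [hx, Pi.zero_apply, mul_zero]

theorem fourierCoeffL1_add (f g : L1 G) (γ : PontryaginDual G) :
    fourierCoeffL1 (f + g) γ = fourierCoeffL1 f γ + fourierCoeffL1 g γ := by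
  let : MeasurableSpace G := borel G
  unfold fourierCoeffL1
  rw [← integral_add (integrable_conj_mul f γ) (integrable_conj_mul g γ)]
  refine integral_congr_ae ?_
  filter_upwards [Lp.coeFn_add f g] with x hx
  rw [hx, Pi.add_apply, mul_add]

theorem fourierCoeffL1_smul (c : ℂ) (f : L1 G) (γ : PontryaginDual G) :
    fourierCoeffL1 (c • f) γ = c * fourierCoeffL1 f γ := by
  let : MeasurableSpace G := borel G
  unfold fourierCoeffL1
  rw [← integral_const_mul]
  refine integral_congr_ae ?_
  filter_upwards [Lp.coeFn_smul c f] with x hx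
  simp only [hx, Pi.smul_apply, smul_eq_mul]
  ring

theorem norm_fourierCoeffL1_le (f : L1 G) (γ : PontryaginDual G) :
    ‖fourierCoeffL1 f γ‖ ≤ ‖f‖ := by
  let : MeasurableSpace G := borel G
  rw [L1.norm_eq_integral_norm]
  refine (norm_integral_le_integral_norm _).trans (le_of_eq ?_)
  refine integral_congr_ae (Filter.Eventually.of_forall fun x => ?_)
  change ‖conj (γ x : ℂ) * f x‖ = ‖f x‖
  rw [norm_mul, RCLike.norm_conj, Circle.norm_coe, one_mul]

theorem continuous_fourierCoeffL1 (γ : PontryaginDual G) :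
    Continuous fun f : L1 G => fourierCoeffL1 f γ :=
  let F : L1 G →ₗ[ℂ] ℂ :=
    { toFun := fun f => fourierCoeffL1 f γ
      map_add' := fun f g => fourierCoeffL1_add f g γ
      map_smul' := fun c f => fourierCoeffL1_smul c f γ }
  (F.mkContinuous 1 fun f => by simpa [F] using norm_fourierCoeffL1_le f γ).continuous

/-- The translation-invariant subspace `L¹_Λ(G)` of all `f` with `spec f ⊆ Λ`. -/
def L1Spec (Λ : Set (PontryaginDual G)) : Submodule ℂ (L1 G) where
  carrier := {f | spec f ⊆ Λ}
  zero_mem' := fun γ hγ => absurd (fourierCoeffL1_zero γ) hγ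
  add_mem' := fun {f g} hf hg γ hγ => by
    by_contra h
    have h1 : fourierCoeffL1 f γ = 0 := not_not.1 fun h' => h (hf h')
    have h2 : fourierCoeffL1 g γ = 0 := not_not.1 fun h' => h (hg h')
    exact hγ (by rw [fourierCoeffL1_add, h1, h2, add_zero])
  smul_mem' := fun c f hf γ hγ => by
    by_contra h
    have h1 : fourierCoeffL1 f γ = 0 := not_not.1 fun h' => h (hf h')
    exact hγ (by rw [fourierCoeffL1_smul, h1, mul_zero])

instance L1Spec.isClosed (Λ : Set (PontryaginDual G)) :
    IsClosed (L1Spec Λ : Set (L1 G)) := by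
  have h : (L1Spec Λ : Set (L1 G)) = ⋂ γ ∈ Λᶜ, {f : L1 G | fourierCoeffL1 f γ = 0} := by
    ext f
    simp only [Set.mem_iInter, Set.mem_compl_iff]
    exact ⟨fun hf γ hγ => not_not.1 fun h' => hγ (hf h'),
      fun hf γ hγ => by_contra fun h' => hγ (hf γ h')⟩
  rw [h]
  exact isClosed_biInter fun γ _ => isClosed_eq (continuous_fourierCoeffL1 γ) continuous_const

end CompactGroup

/-- The identification of `Γ₁ × Γ₂` with the dual group of `G₁ × G₂`: the pair `(γ₁, γ₂)`
corresponds to the character `γ₁ ⊗ γ₂ : (x, y) ↦ γ₁ x * γ₂ y`. -/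
def dualProdEquiv (G₁ G₂ : Type*) [CommGroup G₁] [TopologicalSpace G₁]
    [CommGroup G₂] [TopologicalSpace G₂] :
    PontryaginDual G₁ × PontryaginDual G₂ ≃* PontryaginDual (G₁ × G₂) where
  toFun γ := ContinuousMonoidHom.coprod (γ.1 : G₁ →ₜ* Circle) (γ.2 : G₂ →ₜ* Circle)
  invFun γ := (PontryaginDual.map (ContinuousMonoidHom.inl G₁ G₂) γ,
    PontryaginDual.map (ContinuousMonoidHom.inr G₁ G₂) γ)
  left_inv γ := by
    refine Prod.ext (PontryaginDual.ext fun x => ?_) (PontryaginDual.ext fun y => ?_)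
    · change γ.1 x * γ.2 1 = γ.1 x
      rw [map_one, mul_one]
    · change γ.1 1 * γ.2 y = γ.2 y
      rw [map_one, one_mul]
  right_inv γ := by
    refine PontryaginDual.ext fun x => ?_
    change γ (x.1, 1) * γ (1, x.2) = γ x
    rw [← map_mul]
    simp
  map_mul' γ δ := by
    refine PontryaginDual.ext fun x => ?_
    change (γ.1 x.1 * δ.1 x.1) * (γ.2 x.2 * δ.2 x.2) = (γ.1 x.1 * γ.2 x.2) * (δ.1 x.1 * δ.2 x.2)
    exact mul_mul_mul_comm _ _ _ _

end

/-! Write `E k` for integration along the second factor against a weight `k`; it sends L¹(G₁ × G₂)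
to L¹(G₁). If `k` is a character, the Fourier coefficients of `E k F` are coefficients of `F`, so
for F in L¹_Λ the function `E k F` has spectrum in p[Λ]. This extends to all continuous `k`, since
trigonometric polynomials are dense in C(G₂); that is derived here from compactness of convolution
operators.

The core is that every γ outside p[Λ] produces peaks on G₁ (`HasPeaks`). Given `y = γ 1_A / μ A` and
`x` of norm one, regard both as functions on the product that are constant in the second variable.
Richness gives `Z` of norm one, close to `y` modulo L¹_Λ and almost ℓ¹-orthogonal to `x`. Testing
with `conj γ 1_A` makes `Z` almost concentrated on A × G₂ with phase γ. A fine partition of unity `k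
i` on G₂ cuts `Z` into pieces `w i = E (k i) Z` of total norm at most one. Orthogonality survives
because the partition is fine for `x + Z` (`exists_partition_norm_fiberIntegral`). Every error adds
up over `i` to a small total, while the masses `M i` of the `k i` add up to one, so some piece has
errors small relative to `M i`. Because the γ-coefficient vanishes on L¹_{p[Λ]}, it forces `w i` to
have norm about `M i`; then `w i / M i` is the required peak (`hasPeaks_of_fiberIntegral_mem`).

Peaks imply narrowness. A functional on L¹ is integration against a bounded ψ, and on a set where ψγ
is nearly constant it cannot distinguish `y` from its peak. Arbitrary functions are assembled from
such pieces by ℓ¹-additivity (`HasPeaks.exists_replacement`). The approximation property also gives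
the Daugavet property (`daugavetProperty_of_exists`).

If G₁ is infinite and p[Λ] is everything, the quotient map is zero and small sets supply peaks, as
Haar measure has no atoms. If G₁ is finite, peaks contradict the existence of an atom, so no γ lies
outside p[Λ]. -/

/-! ### Compactness of integral operators with continuous kernel -/

section IntegralOperator

open Filter Topology

variable {X Y : Type*} [TopologicalSpace X] [CompactSpace X] [TopologicalSpace Y] [CompactSpace Y]
  [MeasurableSpace Y] [BorelSpace Y]

theorem ContinuousMap.integrable_of_compactSpace (ν : Measure Y) [IsFiniteMeasure ν]
    (v : C(Y, ℂ)) : Integrable v ν :=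
  v.continuous.integrable_of_hasCompactSupport (HasCompactSupport.of_compactSpace v)

/-- Integration against a finite measure, as a functional on continuous functions. -/
noncomputable def ContinuousMap.integralCLM (ν : Measure Y) [IsFiniteMeasure ν] :
    C(Y, ℂ) →L[ℂ] ℂ :=
  LinearMap.mkContinuous
    { toFun := fun v => ∫ y, v y ∂ν
      map_add' := fun v w => integral_add (v.integrable_of_compactSpace ν)
        (w.integrable_of_compactSpace ν)
      map_smul' := fun c v => integral_const_mul c v } (ν.real Set.univ) fun v => by
    have h := norm_integral_le_of_norm_le_const (μ := ν) (f := v)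
      (Eventually.of_forall fun y => v.norm_coe_le_norm y)
    rw [mul_comm]; exact h

theorem ContinuousMap.continuous_integral_mul {X : Type*} [TopologicalSpace X] (ν : Measure Y)
    [IsFiniteMeasure ν] (F : C(X × Y, ℂ)) (v : C(Y, ℂ)) : Continuous fun x => ∫ y, F (x, y) * v y ∂ν :=
  ((ContinuousMap.integralCLM ν).continuous.comp
    (F.curry.continuous.mul (continuous_const (y := v))))

/-- The integral operator with continuous kernel `F`. -/
noncomputable def integralOp (ν : Measure Y) [IsProbabilityMeasure ν] (F : C(X × Y, ℂ)) :
    C(Y, ℂ) →L[ℂ] C(X, ℂ) :=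
  LinearMap.mkContinuous
    { toFun := fun v => ⟨fun x => ∫ y, F (x, y) * v y ∂ν, F.continuous_integral_mul ν v⟩
      map_add' := fun v w => by
        ext x
        simp only [ContinuousMap.coe_mk, ContinuousMap.add_apply, mul_add]
        exact integral_add ((F.curry x * v).integrable_of_compactSpace ν)
          ((F.curry x * w).integrable_of_compactSpace ν)
      map_smul' := fun c v => by
        ext x
        simp only [ContinuousMap.coe_mk, ContinuousMap.smul_apply, smul_eq_mul, RingHom.id_apply]
        rw [← integral_const_mul]
        congr 1 with y
        ring } ‖F‖ fun v => by
    refine (ContinuousMap.norm_le _ (by positivity)).2 fun x => ?_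
    have h := norm_integral_le_of_norm_le_const (μ := ν) (f := fun y => F (x, y) * v y)
      (C := ‖F‖ * ‖v‖) (Eventually.of_forall fun y => by
        rw [norm_mul]
        gcongr
        exacts [F.norm_coe_le_norm _, v.norm_coe_le_norm _])
    simpa using h

theorem integralOp_apply (ν : Measure Y) [IsProbabilityMeasure ν] (F : C(X × Y, ℂ))
    (v : C(Y, ℂ)) (x : X) : integralOp ν F v x = ∫ y, F (x, y) * v y ∂ν := rfl

/-- Arzelà–Ascoli. For ‖v‖ ≤ 1 the image changes between `x₀` and `x` by at most the sup-distance of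
the two kernel slices. This modulus does not depend on `v`, and it is continuous in `x` because the
curried kernel is. -/
theorem isCompactOperator_integralOp (ν : Measure Y) [IsProbabilityMeasure ν] (F : C(X × Y, ℂ)) :
    IsCompactOperator (integralOp ν F) := by
  set S : Set C(X, ℂ) := integralOp ν F '' Metric.closedBall 0 1
  let e : C(X, ℂ) ≃ᵢ BoundedContinuousFunction X ℂ :=
    (ContinuousMap.isometryEquivBoundedOfCompact X ℂ)
  have hS : IsCompact (closure (e '' S)) := by
    refine BoundedContinuousFunction.arzela_ascoli (Metric.closedBall 0 ‖integralOp ν F‖)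
      (isCompact_closedBall _ _) _ ?_ ?_
    · rintro _ x ⟨_, ⟨v, hv, rfl⟩, rfl⟩
      rw [mem_closedBall_zero_iff] at hv ⊢
      refine ((integralOp ν F v).norm_coe_le_norm x).trans ?_
      exact ((integralOp ν F).le_opNorm v).trans
        (mul_le_of_le_one_right (norm_nonneg _) hv)
    · intro x₀
      refine Metric.equicontinuousAt_of_continuity_modulus
        (fun x => ‖F.curry x₀ - F.curry x‖) ?_ _ (Eventually.of_forall ?_)
      · have h : Continuous fun x => ‖F.curry x₀ - F.curry x‖ := by fun_prop
        simpa using h.tendsto x₀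
      · rintro x ⟨_, ⟨_, ⟨v, hv, rfl⟩, rfl⟩⟩
        rw [mem_closedBall_zero_iff] at hv
        change dist (integralOp ν F v x₀) (integralOp ν F v x) ≤ _
        rw [dist_eq_norm]
        change ‖∫ y, (F.curry x₀ * v) y ∂ν - ∫ y, (F.curry x * v) y ∂ν‖ ≤ _
        rw [← integral_sub ((F.curry x₀ * v).integrable_of_compactSpace ν)
          ((F.curry x * v).integrable_of_compactSpace ν)]
        refine (norm_integral_le_of_norm_le_const (C := ‖F.curry x₀ - F.curry x‖)
          (Eventually.of_forall fun y => ?_)).trans_eq (by simp)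
        change ‖F.curry x₀ y * v y - F.curry x y * v y‖ ≤ _
        rw [← sub_mul, norm_mul]
        exact (mul_le_of_le_one_right (norm_nonneg _) ((v.norm_coe_le_norm y).trans hv)).trans
          ((F.curry x₀ - F.curry x).norm_coe_le_norm y)
  refine ⟨e ⁻¹' closure (e '' S), e.toHomeomorph.isClosedEmbedding.isCompact_preimage hS, ?_⟩
  filter_upwards [Metric.closedBall_mem_nhds (0 : C(Y, ℂ)) one_pos] with v hv
  exact subset_closure ⟨_, ⟨v, hv, rfl⟩, rfl⟩

end IntegralOperator

/-! ### Eigenvalues of compact symmetrizable operators and common eigenvectors -/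

section CompactSymmetrizable

open Filter Topology Module.End

/-- A compact operator on a Banach space that is symmetric with respect to a weaker inner product
has a nonzero eigenvalue, unless it vanishes for that inner product. -/
theorem IsCompactOperator.exists_hasEigenvalue_of_symmetric {E H : Type*} [NormedAddCommGroup E]
    [NormedSpace ℂ E] [CompleteSpace E] [NormedAddCommGroup H] [InnerProductSpace ℂ H]
    (j : E →L[ℂ] H) {T : E →L[ℂ] E} (hT : IsCompactOperator T)
    (hsymm : ∀ u v, inner ℂ (j (T u)) (j v) = inner ℂ (j u) (j (T v)))
    {v : E} (hv : j (T v) ≠ 0) : ∃ c : ℂ, c ≠ 0 ∧ HasEigenvalue (T : Module.End ℂ E) c := by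
  by_contra! hne
  -- Symmetry and Cauchy–Schwarz make `a` log-convex, so its successive ratios never fall below the
  -- first ratio `r` and `a n` grows at least like `r ^ n`. Without nonzero eigenvalues `T` would be
  -- quasinilpotent, which is incompatible with this growth.
  set a : ℕ → ℝ := fun n => ‖j ((T ^ n) v)‖ with ha
  have hlog : ∀ n, a (n + 1) ^ 2 ≤ a n * a (n + 2) := fun n => by
    have h := hsymm ((T ^ n) v) ((T ^ (n + 1)) v)
    rw [← mul_apply_eq_comp, ← mul_apply_eq_comp, ← pow_succ',
      ← pow_succ', inner_self_eq_norm_sq_to_K] at h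
    have h' := norm_inner_le_norm (𝕜 := ℂ) (j ((T ^ n) v)) (j ((T ^ (n + 1 + 1)) v))
    rw [← h] at h'
    simpa [ha] using h'
  have ha1 : 0 < a 1 := by simpa [ha] using hv
  have ha0 : 0 < a 0 := by
    refine lt_of_le_of_ne (norm_nonneg _) fun h => ?_
    have := hlog 0
    rw [← h, zero_mul] at this
    exact absurd this (not_le.2 (pow_pos ha1 2))
  set r := a 1 / a 0 with hr
  have hr0 : 0 < r := div_pos ha1 ha0
  have hstep : ∀ n, 0 < a n ∧ r * a n ≤ a (n + 1) := fun n => by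
    induction n with
    | zero => exact ⟨ha0, by rw [hr, div_mul_cancel₀ _ ha0.ne']⟩
    | succ n ih =>
      have hpos : 0 < a (n + 1) := (mul_pos hr0 ih.1).trans_le ih.2
      refine ⟨hpos, ?_⟩
      have h1 := hlog n
      have h2 : r * a n * a (n + 1) ≤ a n * a (n + 2) :=
        (mul_le_mul_of_nonneg_right ih.2 hpos.le).trans (by rw [← sq]; exact h1)
      have h3 : a n * (r * a (n + 1)) ≤ a n * a (n + 2) := by linarith
      exact le_of_mul_le_mul_left h3 ih.1
  have hgrow : ∀ n, a 0 * r ^ n ≤ a n := fun n => by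
    induction n with
    | zero => simp
    | succ n ih =>
      calc a 0 * r ^ (n + 1) = r * (a 0 * r ^ n) := by ring
        _ ≤ r * a n := by gcongr
        _ ≤ a (n + 1) := (hstep n).2
  -- Fredholm alternative: a nonzero spectral value of a compact operator is an eigenvalue.
  -- Gelfand's formula then bounds ‖T ^ n‖ by `(r / 2) ^ n` eventually.
  have hrad : spectralRadius ℂ T = 0 := by
    refine le_antisymm (iSup₂_le fun k hk => ?_) bot_le
    by_cases hk0 : k = 0
    · simp [hk0]
    · exact absurd ((hT.hasEigenvalue_iff_mem_spectrum hk0).2 hk) (hne k hk0)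
  have hlim := spectrum.pow_norm_pow_one_div_tendsto_nhds_spectralRadius T
  rw [hrad] at hlim
  have hev : ∀ᶠ n : ℕ in atTop, ‖T ^ n‖ < (r / 2) ^ n := by
    filter_upwards [hlim.eventually (gt_mem_nhds (ENNReal.ofReal_pos.2 (half_pos hr0))),
      eventually_gt_atTop 0] with n hn hn0
    rw [ENNReal.ofReal_lt_ofReal_iff (half_pos hr0)] at hn
    have := pow_lt_pow_left₀ hn (by positivity) hn0.ne'
    rwa [← Real.rpow_natCast, ← Real.rpow_mul (norm_nonneg _), one_div,
      inv_mul_cancel₀ (by positivity), Real.rpow_one] at this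
  have hbig : Tendsto (fun n : ℕ => (2 : ℝ) ^ n) atTop atTop :=
    tendsto_pow_atTop_atTop_of_one_lt one_lt_two
  obtain ⟨n, hn, hn'⟩ := (hev.and (hbig.eventually_gt_atTop (‖j‖ * ‖v‖ / a 0))).exists
  have h1 : a n ≤ ‖j‖ * (‖T ^ n‖ * ‖v‖) :=
    (j.le_opNorm _).trans (by gcongr; exact (T ^ n).le_opNorm v)
  have h2 : a 0 * r ^ n ≤ ‖j‖ * ((r / 2) ^ n * ‖v‖) :=
    (hgrow n).trans (h1.trans (by gcongr))
  rw [div_lt_iff₀ ha0] at hn'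
  have h3 : ‖j‖ * ((r / 2) ^ n * ‖v‖) * 2 ^ n = ‖j‖ * ‖v‖ * r ^ n := by
    rw [div_pow]; field_simp
  have h4 : ‖j‖ * ‖v‖ * r ^ n < 2 ^ n * a 0 * r ^ n := by gcongr
  have h5 : a 0 * r ^ n * 2 ^ n ≤ ‖j‖ * ((r / 2) ^ n * ‖v‖) * 2 ^ n := by gcongr
  nlinarith

/-- On the eigenspace the operator is the nonzero scalar `c`, so the identity there is compact. -/
theorem IsCompactOperator.finiteDimensional_eigenspace {E : Type*} [NormedAddCommGroup E]
    [NormedSpace ℂ E] [CompleteSpace E] {T : E →L[ℂ] E} (hT : IsCompactOperator T) {c : ℂ}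
    (hc : c ≠ 0) : FiniteDimensional ℂ (eigenspace (T : Module.End ℂ E) c) := by
  have : IsClosed (eigenspace (T : Module.End ℂ E) c : Set E) := by
    have h : (eigenspace (T : Module.End ℂ E) c : Set E) = {v | T v = c • v} := by
      ext v; simp
    rw [h]
    exact isClosed_eq T.continuous (continuous_const_smul c)
  have : CompleteSpace (eigenspace (T : Module.End ℂ E) c) := this.completeSpace_coe
  replace hT := hT.restrict' (f := (T : Module.End ℂ E))
    ((mem_invtSubmodule_iff_forall_mem_of_mem _).mp (eigenspace_mem_invtSubmodule _ c))
  rw [restrict_eigenspace, LinearMap.coe_smul, IsCompactOperator.smul_iff₀ hc] at hT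
  rwa [← isCompactOperator_id_iff_finiteDimensional]

/-- A commuting family of operators that leaves a nonzero finite-dimensional complex subspace
invariant has a common eigenvector in it. -/
theorem Submodule.exists_common_eigenvector {ι E : Type*} [AddCommGroup E] [Module ℂ E]
    (U : ι → E →ₗ[ℂ] E) (hU : ∀ i k v, U i (U k v) = U k (U i v)) :
    ∀ (n : ℕ) (V : Submodule ℂ E) [FiniteDimensional ℂ V], Module.finrank ℂ V = n → V ≠ ⊥ →
      (∀ i, ∀ v ∈ V, U i v ∈ V) → ∃ v ∈ V, v ≠ 0 ∧ ∀ i, ∃ c : ℂ, U i v = c • v := by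
  intro n
  induction n using Nat.strong_induction_on with
  | _ n ih =>
    intro V _ hn hV hinv
    -- If all operators are scalar on `V`, any nonzero vector works. Otherwise an eigenspace of a
    -- non-scalar one cuts out a smaller nonzero subspace, invariant by commutativity.
    by_cases hs : ∀ i, ∃ c : ℂ, ∀ v ∈ V, U i v = c • v
    · obtain ⟨v, hv, hv0⟩ := V.ne_bot_iff.1 hV
      exact ⟨v, hv, hv0, fun i => (hs i).imp fun c hc => hc v hv⟩
    push Not at hs
    obtain ⟨i, hi⟩ := hs
    have : Nontrivial V := Submodule.nontrivial_iff_ne_bot.2 hV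
    obtain ⟨c, hc⟩ := Module.End.exists_eigenvalue ((U i).restrict (hinv i))
    obtain ⟨w, hw⟩ := hc.exists_hasEigenvector
    obtain ⟨u, hu, hu'⟩ := hi c
    let W : Submodule ℂ E := V ⊓ eigenspace (U i) c
    have hWV : W < V := by
      refine lt_of_le_of_ne inf_le_left fun h => hu' ?_
      have : u ∈ W := h ▸ hu
      exact mem_eigenspace_iff.1 this.2
    have : FiniteDimensional ℂ W := Submodule.finiteDimensional_of_le hWV.le
    obtain ⟨v, hv, h⟩ := ih _ (hn ▸ Submodule.finrank_lt_finrank_of_lt hWV) W rfl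
      (W.ne_bot_iff.2 ⟨w, ⟨w.2, mem_eigenspace_iff.2
        (congrArg Subtype.val hw.apply_eq_smul :)⟩, fun h => hw.2 (Subtype.ext h)⟩)
      (fun k v hv => ⟨hinv k v hv.1, mem_eigenspace_iff.2
        (by rw [hU, mem_eigenspace_iff.1 hv.2, map_smul])⟩)
    exact ⟨v, hv.1, h⟩

end CompactSymmetrizable

/-! ### Convolution operators and completeness of the characters -/

section Characters

open Filter Topology Module.End

variable {G : Type*} [CommGroup G] [TopologicalSpace G]

/-- A character as a complex-valued continuous function. -/
noncomputable def PontryaginDual.toContinuousMap (χ : PontryaginDual G) : C(G, ℂ) :=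
  ⟨fun x => (χ x : ℂ), continuous_subtype_val.comp (map_continuous χ)⟩

theorem PontryaginDual.toContinuousMap_apply (χ : PontryaginDual G) (x : G) :
    χ.toContinuousMap x = (χ x : ℂ) := rfl

theorem PontryaginDual.conj_mul_self (χ : PontryaginDual G) (x : G) :
    conj (χ x : ℂ) * (χ x : ℂ) = 1 := by
  rw [mul_comm, Complex.mul_conj, Circle.normSq_coe, Complex.ofReal_one]

theorem PontryaginDual.coe_apply_mul (χ : PontryaginDual G) (x y : G) :
    (χ (x * y) : ℂ) = (χ x : ℂ) * (χ y : ℂ) :=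
  congrArg (fun z : Circle => (z : ℂ)) (_root_.map_mul χ x y)

variable [IsTopologicalGroup G]

/-- Translation of continuous functions. -/
noncomputable def ContinuousMap.translate (s : G) : C(G, ℂ) →ₗ[ℂ] C(G, ℂ) where
  toFun v := ⟨fun x => v (x * s), by fun_prop⟩
  map_add' _ _ := rfl
  map_smul' _ _ := rfl

theorem ContinuousMap.translate_apply (s x : G) (v : C(G, ℂ)) :
    ContinuousMap.translate s v x = v (x * s) := rfl

/-- The eigenvalue is forced to be `c s = v s / v 1`, hence multiplicative and continuous. Comparing
at a maximum of |v| gives |c s| ≤ 1, and the same bound for the inverse of `s` gives equality. -/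
theorem exists_eq_smul_character [CompactSpace G] {v : C(G, ℂ)} (hv : v ≠ 0)
    (h : ∀ s, ∃ c : ℂ, ContinuousMap.translate s v = c • v) :
    ∃ (χ : PontryaginDual G) (c : ℂ), c ≠ 0 ∧ v = c • χ.toContinuousMap := by
  choose c hc using h
  have hc' : ∀ s x, v (x * s) = c s * v x := fun s x => DFunLike.congr_fun (hc s) x
  have hone : ∀ s, v s = c s * v 1 := fun s => by simpa using hc' s 1
  have h1 : v 1 ≠ 0 := fun h => hv <| by ext s; simp [hone s, h]
  have hcs : ∀ s, c s = v s / v 1 := fun s => by rw [hone s, mul_div_cancel_right₀ _ h1]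
  have hmul : ∀ s t, c (s * t) = c s * c t := fun s t => by
    rw [hcs, hc', hcs, hcs]; field_simp
  have hc1 : c 1 = 1 := by rw [hcs, div_self h1]
  have hle : ∀ s, ‖c s‖ ≤ 1 := fun s => by
    obtain ⟨x, -, hx⟩ := isCompact_univ.exists_isMaxOn ⟨1, Set.mem_univ (1 : G)⟩
      v.continuous.norm.continuousOn
    have hx1 : 0 < ‖v x‖ := (norm_pos_iff.2 h1).trans_le (hx (Set.mem_univ _))
    have := hx (Set.mem_univ (x * s))
    change ‖v (x * s)‖ ≤ ‖v x‖ at this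
    rw [hc', norm_mul] at this
    exact le_of_mul_le_mul_right (this.trans_eq (one_mul _).symm) hx1
  have hnorm : ∀ s, ‖c s‖ = 1 := fun s => by
    refine le_antisymm (hle s) ?_
    have h2 : ‖c s‖ * ‖c s⁻¹‖ = 1 := by rw [← norm_mul, ← hmul, mul_inv_cancel, hc1, norm_one]
    nlinarith [hle s⁻¹, norm_nonneg (c s)]
  have hcont : Continuous c := by
    rw [show c = fun s => v s / v 1 from funext hcs]
    fun_prop
  let χ : G →ₜ* Circle :=
    { toFun := fun s => ⟨c s, mem_sphere_zero_iff_norm.2 (hnorm s)⟩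
      map_one' := Circle.ext hc1
      map_mul' := fun s t => Circle.ext (hmul s t)
      continuous_toFun := hcont.subtype_mk _ }
  refine ⟨χ, v 1, h1, ?_⟩
  ext s
  rw [hone s, mul_comm]
  rfl

variable [CompactSpace G] [MeasurableSpace G] [BorelSpace G] (μ : Measure G)
  [IsProbabilityMeasure μ]

/-- Convolution with `f`, as an operator on continuous functions. -/
noncomputable def convOp (f : C(G, ℂ)) : C(G, ℂ) →L[ℂ] C(G, ℂ) :=
  integralOp μ (⟨fun p => f (p.1 * p.2⁻¹), by fun_prop⟩ : C(G × G, ℂ))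

theorem convOp_apply (f v : C(G, ℂ)) (x : G) :
    convOp μ f v x = ∫ y, f (x * y⁻¹) * v y ∂μ := rfl

theorem convOp_translate [μ.IsMulLeftInvariant] (f v : C(G, ℂ)) (s : G) :
    convOp μ f (ContinuousMap.translate s v) = ContinuousMap.translate s (convOp μ f v) := by
  ext x
  rw [ContinuousMap.translate_apply, convOp_apply, convOp_apply,
    ← integral_mul_right_eq_self (μ := μ) (fun y => f (x * s * y⁻¹) * v y) s]
  refine integral_congr_ae (Eventually.of_forall fun y => ?_)
  dsimp only
  rw [ContinuousMap.translate_apply, mul_inv, mul_mul_mul_comm, mul_inv_cancel, mul_one]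

theorem convOp_symm {f : C(G, ℂ)} (hf : ∀ x, f x⁻¹ = conj (f x)) (u v : C(G, ℂ)) :
    ∫ x, conj (convOp μ f u x) * v x ∂μ = ∫ x, conj (u x) * convOp μ f v x ∂μ := by
  have h1 : ∀ x, conj (convOp μ f u x) * v x =
      ∫ y, conj (f (x * y⁻¹)) * conj (u y) * v x ∂μ := fun x => by
    rw [convOp_apply, ← integral_conj, ← integral_mul_const]
    simp only [map_mul]
  have h2 : ∀ y, conj (u y) * convOp μ f v y =
      ∫ x, conj (f (x * y⁻¹)) * conj (u y) * v x ∂μ := fun y => by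
    rw [convOp_apply, ← integral_const_mul]
    refine integral_congr_ae (Eventually.of_forall fun x => ?_)
    dsimp only
    rw [← hf, mul_inv, inv_inv, mul_comm x⁻¹]
    ring
  simp only [h1, h2]
  refine integral_integral_swap_of_hasCompactSupport ?_ (HasCompactSupport.of_compactSpace _)
  exact (by fun_prop : Continuous fun p : G × G =>
    conj (f (p.1 * p.2⁻¹)) * conj (u p.2) * v p.1)

/-- Convolution commutes with translations, and translations act on a character by scalars;
evaluating at 1 identifies the eigenvalue. -/
theorem convOp_character [μ.IsMulLeftInvariant] (f : C(G, ℂ)) (χ : PontryaginDual G) :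
    convOp μ f χ.toContinuousMap = convOp μ f χ.toContinuousMap 1 • χ.toContinuousMap := by
  have h : ∀ s, ContinuousMap.translate s χ.toContinuousMap = (χ s : ℂ) • χ.toContinuousMap :=
    fun s => by
      ext x
      simp [ContinuousMap.translate_apply, PontryaginDual.toContinuousMap_apply, mul_comm]
  ext x
  have h1 := convOp_translate μ f χ.toContinuousMap x
  rw [h, map_smul] at h1
  have h2 := DFunLike.congr_fun h1 1
  rw [ContinuousMap.translate_apply, one_mul] at h2
  rw [← h2]
  simp [PontryaginDual.toContinuousMap_apply, mul_comm]

/-- The continuous functions all of whose Fourier coefficients vanish. -/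
noncomputable def nullSpectrum : Submodule ℂ C(G, ℂ) where
  carrier := {v | ∀ χ : PontryaginDual G, ∫ x, conj (χ x : ℂ) * v x ∂μ = 0}
  zero_mem' χ := by simp
  add_mem' {v w} hv hw χ := by
    have h := integral_add ((star χ.toContinuousMap * v).integrable_of_compactSpace μ)
      ((star χ.toContinuousMap * w).integrable_of_compactSpace μ)
    simp only [ContinuousMap.add_apply, mul_add]
    refine h.trans ?_
    rw [show ∫ x, (star χ.toContinuousMap * v) x ∂μ = 0 from hv χ,
      show ∫ x, (star χ.toContinuousMap * w) x ∂μ = 0 from hw χ, add_zero]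
  smul_mem' c v hv χ := by
    have h : ∀ x, conj (χ x : ℂ) * (c • v) x = c * (conj (χ x : ℂ) * v x) := fun x => by
      simp only [ContinuousMap.smul_apply, smul_eq_mul]; ring
    simp only [h, integral_const_mul, hv χ, mul_zero]

theorem isClosed_nullSpectrum : IsClosed (nullSpectrum μ : Set C(G, ℂ)) := by
  have : (nullSpectrum μ : Set C(G, ℂ)) = ⋂ χ : PontryaginDual G,
      {v | ContinuousMap.integralCLM μ (star χ.toContinuousMap * v) = 0} := by
    ext v
    rw [Set.mem_iInter]
    rfl
  rw [this]
  exact isClosed_iInter fun χ => isClosed_eq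
    ((ContinuousMap.integralCLM μ).continuous.comp (continuous_const.mul continuous_id))
    continuous_const

theorem translate_mem_nullSpectrum [μ.IsMulLeftInvariant] {v : C(G, ℂ)} (hv : v ∈ nullSpectrum μ)
    (s : G) : ContinuousMap.translate s v ∈ nullSpectrum μ := fun χ => by
  have h : ∀ x, conj (χ x : ℂ) * ContinuousMap.translate s v x =
      (χ s : ℂ) * (conj (χ (x * s) : ℂ) * v (x * s)) := fun x => by
    rw [ContinuousMap.translate_apply, χ.coe_apply_mul, map_mul (starRingEnd ℂ)]
    linear_combination (-conj (χ x : ℂ) * v (x * s)) * χ.conj_mul_self s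
  simp only [h, integral_const_mul]
  rw [integral_mul_right_eq_self (fun x => conj (χ x : ℂ) * v x) s, hv χ, mul_zero]

/-- By symmetry the operator may be moved to the character, which it only rescales. -/
theorem convOp_mem_nullSpectrum [μ.IsMulLeftInvariant] {f : C(G, ℂ)}
    (hf : ∀ x, f x⁻¹ = conj (f x)) {v : C(G, ℂ)} (hv : v ∈ nullSpectrum μ) :
    convOp μ f v ∈ nullSpectrum μ := fun χ => by
  have h := convOp_symm μ hf χ.toContinuousMap v
  rw [convOp_character] at h
  refine h.symm.trans ?_
  have h' : ∀ x, conj ((convOp μ f χ.toContinuousMap 1 • χ.toContinuousMap) x) * v x =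
      conj (convOp μ f χ.toContinuousMap 1) * (conj (χ x : ℂ) * v x) := fun x => by
    simp only [ContinuousMap.smul_apply, smul_eq_mul, map_mul,
      PontryaginDual.toContinuousMap_apply, mul_assoc]
  simp only [h', integral_const_mul, hv χ, mul_zero]

/-- Convolution with a nonnegative bump near 1 averages `v` over points where it differs from `v x₀`
by less than half of |v x₀|, so the result cannot vanish at `x₀`. -/
theorem exists_convOp_ne_zero [T2Space G] [μ.IsHaarMeasure] {v : C(G, ℂ)} (hv : v ≠ 0) :
    ∃ f : C(G, ℂ), (∀ x, f x⁻¹ = conj (f x)) ∧ convOp μ f v ≠ 0 := by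
  obtain ⟨x₀, hx₀⟩ := DFunLike.ne_iff.1 hv
  rw [ContinuousMap.zero_apply] at hx₀
  have hU : IsClosed {x : G | ‖v x₀‖ / 2 ≤ ‖v (x⁻¹ * x₀) - v x₀‖} :=
    isClosed_le continuous_const (by fun_prop)
  obtain ⟨g, hg0, hg1, hg⟩ := exists_continuous_zero_one_of_isClosed hU
    (isClosed_singleton (x := (1 : G))) (Set.disjoint_singleton_right.2 (by simpa using hx₀))
  -- Multiplying by the reflected bump makes the kernel symmetric without enlarging its support.
  let w : G → ℝ := fun x => g x * g x⁻¹
  have hw0 : ∀ x, 0 ≤ w x := fun x => mul_nonneg (hg x).1 (hg x⁻¹).1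
  have hwc : Continuous w := by fun_prop
  have hw1 : w 1 = 1 := by
    simp [w, hg1 (Set.mem_singleton 1)]
  refine ⟨⟨fun x => (w x : ℂ), by fun_prop⟩, fun x => ?_, fun h => ?_⟩
  · simp [w, mul_comm]
  have hI : 0 < ∫ y, w (x₀ * y⁻¹) ∂μ :=
    Continuous.integral_pos_of_hasCompactSupport_nonneg_nonzero (x := x₀) (by fun_prop)
      (HasCompactSupport.of_compactSpace _) (fun y => hw0 _) (by simp [hw1])
  have h1 := DFunLike.congr_fun h x₀
  rw [convOp_apply, ContinuousMap.zero_apply] at h1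
  simp only [ContinuousMap.coe_mk] at h1
  have hi : Integrable (fun y => w (x₀ * y⁻¹)) μ :=
    Continuous.integrable_of_hasCompactSupport (by fun_prop) (HasCompactSupport.of_compactSpace _)
  have hi' : Integrable (fun y => (w (x₀ * y⁻¹) : ℂ) * v y) μ :=
    Continuous.integrable_of_hasCompactSupport (by fun_prop) (HasCompactSupport.of_compactSpace _)
  have hi'' : Integrable (fun y => (w (x₀ * y⁻¹) : ℂ) * v x₀) μ := hi.ofReal.mul_const _
  have h2 : ∫ y, (w (x₀ * y⁻¹) : ℂ) * (v x₀ - v y) ∂μ = (∫ y, w (x₀ * y⁻¹) ∂μ : ℝ) * v x₀ := by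
    simp only [mul_sub]
    rw [integral_sub hi'' hi', h1, sub_zero, integral_mul_const,
      integral_complex_ofReal]
  have h3 : ‖∫ y, (w (x₀ * y⁻¹) : ℂ) * (v x₀ - v y) ∂μ‖ ≤
      ∫ y, w (x₀ * y⁻¹) * (‖v x₀‖ / 2) ∂μ := by
    refine norm_integral_le_of_norm_le (hi.mul_const _) (Eventually.of_forall fun y => ?_)
    rw [norm_mul, Complex.norm_real, Real.norm_of_nonneg (hw0 _)]
    by_cases hy : x₀ * y⁻¹ ∈ {x : G | ‖v x₀‖ / 2 ≤ ‖v (x⁻¹ * x₀) - v x₀‖}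
    · simp [w, hg0 hy]
    · refine mul_le_mul_of_nonneg_left ?_ (hw0 _)
      simp only [Set.mem_ofPred, not_le, mul_inv, inv_inv] at hy
      rw [mul_right_comm, inv_mul_cancel, one_mul, norm_sub_rev] at hy
      exact hy.le
  rw [h2, integral_mul_const, norm_mul, Complex.norm_real, Real.norm_of_nonneg hI.le] at h3
  have := norm_pos_iff.2 hx₀
  nlinarith

/-- The Peter–Weyl argument. On a nonzero null spectrum some hermitian convolution is compact,
nonzero and symmetric for the L² inner product, so it has a finite-dimensional nonzero eigenspace.
Translations commute and preserve it; a common eigenvector is a multiple of a character, yet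
orthogonal to all characters. -/
theorem nullSpectrum_eq_bot [T2Space G] [μ.IsHaarMeasure] : nullSpectrum μ = ⊥ := by
  rw [Submodule.eq_bot_iff]
  intro v hv
  by_contra hv0
  obtain ⟨f, hf, hfv⟩ := exists_convOp_ne_zero μ hv0
  have hcl := isClosed_nullSpectrum μ
  have : CompleteSpace (nullSpectrum μ) := hcl.completeSpace_coe
  let T : nullSpectrum μ →L[ℂ] nullSpectrum μ :=
    ((convOp μ f).comp (nullSpectrum μ).subtypeL).codRestrict _
      fun w => convOp_mem_nullSpectrum μ hf w.2
  have hT : IsCompactOperator T :=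
    ((isCompactOperator_integralOp μ _).comp_clm (nullSpectrum μ).subtypeL).codRestrict _ hcl
  let j : nullSpectrum μ →L[ℂ] Lp ℂ 2 μ :=
    (ContinuousMap.toLp 2 μ ℂ).comp (nullSpectrum μ).subtypeL
  obtain ⟨c, hc0, hc⟩ := hT.exists_hasEigenvalue_of_symmetric j (v := ⟨v, hv⟩)
    (fun u w => by
      change inner ℂ (ContinuousMap.toLp 2 μ ℂ (convOp μ f u)) (ContinuousMap.toLp 2 μ ℂ w.1) =
        inner ℂ (ContinuousMap.toLp 2 μ ℂ u.1) (ContinuousMap.toLp 2 μ ℂ (convOp μ f w))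
      rw [ContinuousMap.inner_toLp, ContinuousMap.inner_toLp]
      simpa only [mul_comm] using convOp_symm μ hf u.1 w.1)
    (fun h => hfv (ContinuousMap.toLp_injective (p := 2) (𝕜 := ℂ) μ (h.trans (map_zero _).symm)))
  have := hT.finiteDimensional_eigenspace hc0
  let V : Submodule ℂ C(G, ℂ) :=
    (eigenspace (T : Module.End ℂ (nullSpectrum μ)) c).map (nullSpectrum μ).subtype
  have hmem : ∀ w, w ∈ V ↔ w ∈ nullSpectrum μ ∧ convOp μ f w = c • w := fun w => by
    rw [Submodule.mem_map]
    constructor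
    · rintro ⟨u, hu, rfl⟩
      exact ⟨u.2, congrArg Subtype.val (mem_eigenspace_iff.1 hu)⟩
    · rintro ⟨h1, h2⟩
      exact ⟨⟨w, h1⟩, mem_eigenspace_iff.2 (Subtype.ext h2), rfl⟩
  obtain ⟨u, hu⟩ := hc.exists_hasEigenvector
  obtain ⟨w, hwV, hw0, hw⟩ := Submodule.exists_common_eigenvector
    (ContinuousMap.translate (G := G))
    (fun s t v => by
      ext x
      simp only [ContinuousMap.translate_apply, mul_assoc, mul_comm s]) _ V rfl
    (V.ne_bot_iff.2 ⟨u, (hmem _).2 ⟨u.2, congrArg Subtype.val hu.apply_eq_smul⟩,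
      fun h => hu.2 (Subtype.ext h)⟩)
    (fun s w hw => by
      rw [hmem] at hw ⊢
      exact ⟨translate_mem_nullSpectrum μ hw.1 s, by rw [convOp_translate, hw.2, map_smul]⟩)
  obtain ⟨χ, d, hd, rfl⟩ := exists_eq_smul_character hw0 hw
  have h1 := ((hmem _).1 hwV).1 χ
  have h2 : ∀ x, conj (χ x : ℂ) * (d • χ.toContinuousMap) x = d := fun x => by
    rw [ContinuousMap.smul_apply, smul_eq_mul, PontryaginDual.toContinuousMap_apply]
    linear_combination d * χ.conj_mul_self x
  simp only [h2] at h1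
  simp [hd] at h1

end Characters

/-! ### Characters separate points; density of trigonometric polynomials -/

section Separation

variable {G : Type*} [CommGroup G] [TopologicalSpace G] [IsTopologicalGroup G] [CompactSpace G]
  [T2Space G]

/-- The characters of a compact abelian group separate its points. -/
theorem PontryaginDual.exists_apply_ne_one {s : G} (hs : s ≠ 1) :
    ∃ χ : PontryaginDual G, χ s ≠ 1 := by
  by_contra! h
  let : MeasurableSpace G := borel G
  have : BorelSpace G := ⟨rfl⟩
  let μ : Measure G := Measure.haarMeasure ⊤
  have : IsProbabilityMeasure μ := haarProb.isProbabilityMeasure G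
  obtain ⟨g, hg0, hg1, -⟩ := exists_continuous_zero_one_of_isClosed
    (isClosed_singleton (x := (1 : G))) (isClosed_singleton (x := s))
    (Set.disjoint_singleton.2 hs.symm)
  let v : C(G, ℂ) := ⟨fun x => (g x : ℂ), by fun_prop⟩
  -- If all characters are 1 at `s`, translation by `s` changes no Fourier coefficient. Then `v`
  -- would be `s`-periodic, although it separates 1 from `s`.
  have hv : ContinuousMap.translate s v - v ∈ nullSpectrum μ := fun χ => by
    have h1 : ∀ x, conj (χ x : ℂ) * (ContinuousMap.translate s v - v) x =
        conj (χ (x * s) : ℂ) * v (x * s) - conj (χ x : ℂ) * v x := fun x => by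
      rw [ContinuousMap.sub_apply, ContinuousMap.translate_apply, χ.coe_apply_mul, h χ,
        Circle.coe_one, mul_one]
      ring
    have hi : Integrable (fun x => conj (χ x : ℂ) * v x) μ :=
      (star χ.toContinuousMap * v).integrable_of_compactSpace μ
    have hi' : Integrable (fun x => conj (χ (x * s) : ℂ) * v (x * s)) μ := hi.comp_mul_right s
    simp only [h1]
    rw [integral_sub hi' hi,
      integral_mul_right_eq_self (fun x => conj (χ x : ℂ) * v x) s, sub_self]
  rw [nullSpectrum_eq_bot, Submodule.mem_bot] at hv
  have := DFunLike.congr_fun hv 1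
  rw [ContinuousMap.sub_apply, ContinuousMap.translate_apply, one_mul] at this
  simp [v, hg0 (Set.mem_singleton 1), hg1 (Set.mem_singleton s)] at this

/-- The trigonometric polynomials on a compact abelian group are dense in the continuous
functions. -/
theorem PontryaginDual.span_toContinuousMap_closure_eq_top :
    (Submodule.span ℂ (Set.range (PontryaginDual.toContinuousMap (G := G)))).topologicalClosure =
      ⊤ := by
  let A : StarSubalgebra ℂ C(G, ℂ) :=
    { toSubalgebra := Algebra.adjoin ℂ (Set.range (PontryaginDual.toContinuousMap (G := G)))
      star_mem' := by
        change Algebra.adjoin ℂ (Set.range (PontryaginDual.toContinuousMap (G := G))) ≤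
          star (Algebra.adjoin ℂ (Set.range (PontryaginDual.toContinuousMap (G := G))))
        refine Algebra.adjoin_le ?_
        rintro - ⟨χ, rfl⟩
        refine Algebra.subset_adjoin ⟨χ⁻¹, ?_⟩
        ext x
        exact Circle.coe_inv_eq_conj (χ x) }
  -- Products of characters are characters, so their span is already the algebra to which
  -- Stone–Weierstrass applies.
  have hA : Subalgebra.toSubmodule A.toSubalgebra =
      Submodule.span ℂ (Set.range (PontryaginDual.toContinuousMap (G := G))) := by
    refine Algebra.adjoin_eq_span_of_subset ℂ (Set.Subset.trans ?_ Submodule.subset_span)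
    intro v hv
    refine Submonoid.closure_induction (fun _ => id) ⟨1, ?_⟩ ?_ hv
    · rfl
    · rintro - - - - ⟨χ, rfl⟩ ⟨ψ, rfl⟩
      exact ⟨χ * ψ, rfl⟩
  rw [← hA]
  refine congr_arg (Subalgebra.toSubmodule <| StarSubalgebra.toSubalgebra ·)
    (ContinuousMap.starSubalgebra_topologicalClosure_eq_top_of_separatesPoints A ?_)
  intro x y hxy
  obtain ⟨χ, hχ⟩ := PontryaginDual.exists_apply_ne_one (mt div_eq_one.1 hxy)
  refine ⟨_, ⟨χ.toContinuousMap, Algebra.subset_adjoin ⟨χ, rfl⟩, rfl⟩, fun h => hχ ?_⟩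
  rw [map_div, div_eq_one]
  exact Circle.ext h

end Separation

/-! ### Functionals on L¹ given by bounded functions -/

section Pairing

variable {X : Type*} [MeasurableSpace X] {μ : Measure X}

/-- Integration against a bounded measurable function, as a functional on `L¹`. -/
noncomputable def l1Pairing (g : X → ℂ) (hg : Measurable g) (C : ℝ) (hC : ∀ x, ‖g x‖ ≤ C) :
    Lp ℂ 1 μ →L[ℂ] ℂ :=
  LinearMap.mkContinuous
    { toFun := fun f => ∫ x, g x * f x ∂μ
      map_add' := fun f h => by
        rw [← integral_add
          ((L1.integrable_coeFn f).bdd_mul hg.aestronglyMeasurable (Filter.Eventually.of_forall hC))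
          ((L1.integrable_coeFn h).bdd_mul hg.aestronglyMeasurable
            (Filter.Eventually.of_forall hC))]
        refine integral_congr_ae ?_
        filter_upwards [Lp.coeFn_add f h] with x hx
        rw [hx, Pi.add_apply, mul_add]
      map_smul' := fun c f => by
        rw [RingHom.id_apply, smul_eq_mul, ← integral_const_mul]
        refine integral_congr_ae ?_
        filter_upwards [Lp.coeFn_smul c f] with x hx
        simp only [hx, Pi.smul_apply, smul_eq_mul]
        ring } C fun f => by
    rw [L1.norm_eq_integral_norm, ← integral_const_mul]
    refine norm_integral_le_of_norm_le ((L1.integrable_coeFn f).norm.const_mul C)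
      (Filter.Eventually.of_forall fun x => ?_)
    rw [norm_mul]
    exact mul_le_mul_of_nonneg_right (hC x) (norm_nonneg _)

theorem l1Pairing_apply (g : X → ℂ) (hg : Measurable g) (C : ℝ) (hC : ∀ x, ‖g x‖ ≤ C)
    (f : Lp ℂ 1 μ) : l1Pairing g hg C hC f = ∫ x, g x * f x ∂μ := rfl

end Pairing

/-! ### Fibre integration on a product of compact spaces -/

section ProductIntegral

open Filter Topology

variable {X Y : Type*} [TopologicalSpace X] [CompactSpace X] [TopologicalSpace Y] [CompactSpace Y]
  [MeasurableSpace X] [BorelSpace X] [MeasurableSpace Y] [BorelSpace Y]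
  [MeasurableSpace (X × Y)] [BorelSpace (X × Y)]
  (μ : Measure X) [IsProbabilityMeasure μ] (ν : Measure Y) [IsProbabilityMeasure ν]
  (ρ : Measure (X × Y)) [IsProbabilityMeasure ρ]

/-- The Borel measure `ρ` integrates continuous functions as the product of `μ` and `ν` does. -/
def IsProductIntegral : Prop :=
  ∀ F : C(X × Y, ℂ), ∫ p, F p ∂ρ = ∫ x, ∫ y, F (x, y) ∂ν ∂μ

theorem ContinuousMap.norm_toLp_one (f : C(X, ℂ)) :
    ‖ContinuousMap.toLp 1 μ ℂ f‖ = ∫ x, ‖f x‖ ∂μ := by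
  rw [L1.norm_eq_integral_norm]
  refine integral_congr_ae ?_
  filter_upwards [ContinuousMap.coeFn_toLp (p := 1) (𝕜 := ℂ) μ f] with x hx
  rw [hx]

theorem l1Pairing_toLp (g : X → ℂ) (hg : Measurable g) (C : ℝ) (hC : ∀ x, ‖g x‖ ≤ C)
    (f : C(X, ℂ)) : l1Pairing (μ := μ) g hg C hC (ContinuousMap.toLp 1 μ ℂ f) =
      ∫ x, g x * f x ∂μ := by
  rw [l1Pairing_apply]
  refine integral_congr_ae ?_
  filter_upwards [ContinuousMap.coeFn_toLp (p := 1) (𝕜 := ℂ) μ f] with x hx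
  rw [hx]

variable {μ ν ρ}

theorem IsProductIntegral.norm_toLp (h : IsProductIntegral μ ν ρ) (F : C(X × Y, ℂ)) :
    ‖ContinuousMap.toLp 1 ρ ℂ F‖ = ∫ x, ∫ y, ‖F (x, y)‖ ∂ν ∂μ := by
  have h1 := h ⟨fun p => (‖F p‖ : ℂ), by fun_prop⟩
  simp only [ContinuousMap.coe_mk, integral_complex_ofReal] at h1
  rw [ContinuousMap.norm_toLp_one]
  exact_mod_cast h1

theorem continuous_integral_norm (F : C(X × Y, ℂ)) : Continuous fun x => ∫ y, ‖F (x, y)‖ ∂ν := by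
  have h := ContinuousMap.continuous_integral_mul ν
    (⟨fun p => (‖F p‖ : ℂ), by fun_prop⟩ : C(X × Y, ℂ)) 1
  simp only [ContinuousMap.coe_mk, ContinuousMap.one_apply, mul_one, integral_complex_ofReal] at h
  exact Complex.continuous_re.comp h

variable (ν) in
/-- Fibrewise integration of continuous functions against `k`, linear in the function. -/
noncomputable def fiberIntegralₗ (k : C(Y, ℂ)) : C(X × Y, ℂ) →ₗ[ℂ] C(X, ℂ) where
  toFun F := integralOp ν F k
  map_add' F H := by
    ext x
    simp only [integralOp_apply, ContinuousMap.add_apply, add_mul]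
    exact integral_add ((F.curry x * k).integrable_of_compactSpace ν)
      ((H.curry x * k).integrable_of_compactSpace ν)
  map_smul' c F := by
    ext x
    simp only [integralOp_apply, ContinuousMap.smul_apply, smul_eq_mul, RingHom.id_apply,
      mul_assoc, integral_const_mul]

theorem fiberIntegralₗ_apply (k : C(Y, ℂ)) (F : C(X × Y, ℂ)) (x : X) :
    fiberIntegralₗ ν k F x = ∫ y, F (x, y) * k y ∂ν := rfl

/-- The bound holds fibrewise under the integral over `X`. Summing over a whole family at once is
essential: for a partition of unity the total loss is a factor 1, however many pieces there are. -/
theorem sum_norm_fiberIntegralₗ_le (h : IsProductIntegral μ ν ρ) {ι : Type*} (s : Finset ι)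
    (k : ι → C(Y, ℂ)) {C : ℝ} (hk : ∀ y, ∑ i ∈ s, ‖k i y‖ ≤ C) (F : C(X × Y, ℂ)) :
    ∑ i ∈ s, ‖ContinuousMap.toLp 1 μ ℂ (fiberIntegralₗ ν (k i) F)‖ ≤
      C * ‖ContinuousMap.toLp 1 ρ ℂ F‖ := by
  simp only [ContinuousMap.norm_toLp_one μ, h.norm_toLp]
  rw [← integral_finsetSum _ fun i _ =>
    ((fiberIntegralₗ ν (k i) F).integrable_of_compactSpace μ).norm, ← integral_const_mul]
  refine integral_mono
    (integrable_finsetSum _ fun i _ =>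
      ((fiberIntegralₗ ν (k i) F).integrable_of_compactSpace μ).norm)
    (((continuous_integral_norm F).integrable_of_hasCompactSupport
      (HasCompactSupport.of_compactSpace _)).const_mul C) fun x => ?_
  dsimp only
  have hi : ∀ i ∈ s, Integrable (fun y => ‖F (x, y)‖ * ‖k i y‖) ν := fun i _ =>
    Continuous.integrable_of_hasCompactSupport (by fun_prop) (HasCompactSupport.of_compactSpace _)
  calc ∑ i ∈ s, ‖fiberIntegralₗ ν (k i) F x‖
      ≤ ∑ i ∈ s, ∫ y, ‖F (x, y)‖ * ‖k i y‖ ∂ν := by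
        refine Finset.sum_le_sum fun i _ => ?_
        rw [fiberIntegralₗ_apply]
        exact (norm_integral_le_integral_norm _).trans_eq (by simp only [norm_mul])
    _ = ∫ y, ‖F (x, y)‖ * ∑ i ∈ s, ‖k i y‖ ∂ν := by
        rw [← integral_finsetSum _ hi]
        simp only [Finset.mul_sum]
    _ ≤ ∫ y, ‖F (x, y)‖ * C ∂ν := by
        refine integral_mono
          (Continuous.integrable_of_hasCompactSupport (by fun_prop)
            (HasCompactSupport.of_compactSpace _))
          (Continuous.integrable_of_hasCompactSupport (by fun_prop)
            (HasCompactSupport.of_compactSpace _)) fun y => ?_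
        exact mul_le_mul_of_nonneg_left (hk y) (norm_nonneg _)
    _ = C * ∫ y, ‖F (x, y)‖ ∂ν := by rw [integral_mul_const, mul_comm]

variable (μ ν ρ) in
/-- Fibrewise integration against `k`, as an operator from `L¹` of the product. -/
noncomputable def fiberIntegral (k : C(Y, ℂ)) : Lp ℂ 1 ρ →L[ℂ] Lp ℂ 1 μ :=
  ((ContinuousMap.toLp 1 μ ℂ).toLinearMap ∘ₗ fiberIntegralₗ ν k).extendOfNorm
    (ContinuousMap.toLp 1 ρ ℂ : C(X × Y, ℂ) →L[ℂ] Lp ℂ 1 ρ).toLinearMap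

variable [T2Space X] [T2Space Y] [ρ.WeaklyRegular]

variable (ρ) in
theorem denseRange_toLp_one :
    DenseRange (ContinuousMap.toLp 1 ρ ℂ : C(X × Y, ℂ) →L[ℂ] Lp ℂ 1 ρ) :=
  ContinuousMap.toLp_denseRange ℂ ρ ℂ ENNReal.one_ne_top

/-- The one-weight case of the norm bound is what makes the extension from the dense continuous
functions legitimate. -/
theorem fiberIntegral_toLp (h : IsProductIntegral μ ν ρ) (k : C(Y, ℂ)) (F : C(X × Y, ℂ)) :
    fiberIntegral μ ν ρ k (ContinuousMap.toLp 1 ρ ℂ F) =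
      ContinuousMap.toLp 1 μ ℂ (fiberIntegralₗ ν k F) := by
  refine LinearMap.extendOfNorm_eq (denseRange_toLp_one ρ) ⟨‖k‖, fun F => ?_⟩ F
  have := sum_norm_fiberIntegralₗ_le h {()} (fun _ => k) (C := ‖k‖)
    (fun y => by simpa using k.norm_coe_le_norm y) F
  simpa using this

theorem sum_norm_fiberIntegral_le (h : IsProductIntegral μ ν ρ) {ι : Type*} (s : Finset ι)
    (k : ι → C(Y, ℂ)) {C : ℝ} (hk : ∀ y, ∑ i ∈ s, ‖k i y‖ ≤ C) (F : Lp ℂ 1 ρ) :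
    ∑ i ∈ s, ‖fiberIntegral μ ν ρ (k i) F‖ ≤ C * ‖F‖ := by
  refine (denseRange_toLp_one ρ).induction_on F (isClosed_le (by fun_prop) (by fun_prop))
    fun F => ?_
  simp only [fiberIntegral_toLp h]
  exact sum_norm_fiberIntegralₗ_le h s k hk F

theorem fiberIntegral_add (h : IsProductIntegral μ ν ρ) (k l : C(Y, ℂ)) (F : Lp ℂ 1 ρ) :
    fiberIntegral μ ν ρ (k + l) F = fiberIntegral μ ν ρ k F + fiberIntegral μ ν ρ l F := by
  refine (denseRange_toLp_one ρ).induction_on F (isClosed_eq (by fun_prop) (by fun_prop))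
    fun F => ?_
  simp only [fiberIntegral_toLp h, ← map_add]
  congr 1
  exact map_add (integralOp ν F) k l

theorem fiberIntegral_smul (h : IsProductIntegral μ ν ρ) (c : ℂ) (k : C(Y, ℂ)) (F : Lp ℂ 1 ρ) :
    fiberIntegral μ ν ρ (c • k) F = c • fiberIntegral μ ν ρ k F := by
  refine (denseRange_toLp_one ρ).induction_on F (isClosed_eq (by fun_prop) (by fun_prop))
    fun F => ?_
  rw [fiberIntegral_toLp h, fiberIntegral_toLp h, ← map_smul (ContinuousMap.toLp 1 μ ℂ)]
  congr 1
  exact map_smul (integralOp ν F) c k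

/-- Fibrewise integration of a fixed function, as an operator in the weight. -/
noncomputable def fiberIntegralWeight (h : IsProductIntegral μ ν ρ) (F : Lp ℂ 1 ρ) :
    C(Y, ℂ) →L[ℂ] Lp ℂ 1 μ :=
  LinearMap.mkContinuous
    { toFun := fun k => fiberIntegral μ ν ρ k F
      map_add' := fun k l => fiberIntegral_add h k l F
      map_smul' := fun c k => fiberIntegral_smul h c k F } ‖F‖ fun k => by
    have := sum_norm_fiberIntegral_le h {()} (fun _ => k) (C := ‖k‖)
      (fun y => by simpa using k.norm_coe_le_norm y) F
    rw [mul_comm]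
    simpa using this

theorem l1Pairing_fiberIntegral (h : IsProductIntegral μ ν ρ) (a : C(X, ℂ)) (k : C(Y, ℂ))
    (F : Lp ℂ 1 ρ) :
    ∫ x, a x * fiberIntegral μ ν ρ k F x ∂μ = ∫ p, a p.1 * k p.2 * F p ∂ρ := by
  let g : C(X × Y, ℂ) := ⟨fun p => a p.1 * k p.2, by fun_prop⟩
  change l1Pairing a a.continuous.measurable ‖a‖ a.norm_coe_le_norm (fiberIntegral μ ν ρ k F) =
    l1Pairing g g.continuous.measurable ‖g‖ g.norm_coe_le_norm F
  refine (denseRange_toLp_one ρ).induction_on F (isClosed_eq (by fun_prop) (by fun_prop))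
    fun F => ?_
  rw [fiberIntegral_toLp h, l1Pairing_toLp, l1Pairing_toLp]
  refine Eq.trans ?_ (h (g * F)).symm
  refine integral_congr_ae (Eventually.of_forall fun x => ?_)
  dsimp only
  rw [fiberIntegralₗ_apply, ← integral_const_mul]
  refine integral_congr_ae (Eventually.of_forall fun y => ?_)
  simp only [ContinuousMap.mul_apply, g, ContinuousMap.coe_mk]
  ring

theorem fiberIntegral_compMeasurePreserving [μ.WeaklyRegular] (h : IsProductIntegral μ ν ρ)
    (hfst : MeasurePreserving Prod.fst ρ μ) (k : C(Y, ℂ)) (f : Lp ℂ 1 μ) :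
    fiberIntegral μ ν ρ k (Lp.compMeasurePreservingₗᵢ ℂ Prod.fst hfst f) =
      (∫ y, k y ∂ν) • f := by
  refine (ContinuousMap.toLp_denseRange ℂ μ ℂ ENNReal.one_ne_top).induction_on f
    (isClosed_eq (by fun_prop) (by fun_prop)) fun f => ?_
  have h1 : Lp.compMeasurePreservingₗᵢ ℂ Prod.fst hfst (ContinuousMap.toLp 1 μ ℂ f) =
      ContinuousMap.toLp 1 ρ ℂ (f.comp ContinuousMap.fst) := by
    have h2 := hfst.quasiMeasurePreserving.ae_eq_comp
      (ContinuousMap.coeFn_toLp (p := 1) (𝕜 := ℂ) μ f)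
    have h3 := ContinuousMap.coeFn_toLp (p := 1) (𝕜 := ℂ) ρ (f.comp ContinuousMap.fst)
    exact Lp.ext ((Lp.coeFn_compMeasurePreserving _ hfst).trans (h2.trans h3.symm))
  rw [h1, fiberIntegral_toLp h, ← map_smul]
  congr 1
  ext x
  rw [fiberIntegralₗ_apply]
  exact (integral_const_mul (f x) _).trans (mul_comm _ _)

/-- A real function as a complex-valued one. -/
noncomputable def ContinuousMap.complexify (k : C(Y, ℝ)) : C(Y, ℂ) :=
  ⟨fun y => (k y : ℂ), by fun_prop⟩

/-- Averaging loses norm only through cancellation within a fibre. A continuous function is almost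
constant, uniformly in the first variable, on small parts of the second factor, so there is almost
no cancellation there. -/
theorem exists_partition_norm_fiberIntegral (h : IsProductIntegral μ ν ρ) (F : Lp ℂ 1 ρ) {η : ℝ}
    (hη : 0 < η) : ∃ (t : Finset Y) (k : t → C(Y, ℝ)),
      (∀ i y, 0 ≤ k i y) ∧ (∀ y, ∑ i, k i y = 1) ∧
      ‖F‖ - η ≤ ∑ i, ‖fiberIntegral μ ν ρ (k i).complexify F‖ := by
  obtain ⟨F', hF'⟩ := (denseRange_toLp_one ρ).exists_dist_lt F (by positivity : 0 < η / 4)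
  -- Viewing `F'` as a continuous map into C(X) gives oscillation bounds uniform in `x`.
  let Φ : C(Y, C(X, ℂ)) := (F'.comp ContinuousMap.prodSwap).curry
  obtain ⟨t, ht⟩ := isCompact_univ.elim_finite_subcover
    (fun t : Y => {s : Y | ‖Φ s - Φ t‖ < η / 4})
    (fun t => isOpen_lt (by fun_prop) continuous_const)
    (fun s _ => Set.mem_iUnion.2 ⟨s, by simpa using by positivity⟩)
  obtain ⟨p, hp⟩ := PartitionOfUnity.exists_isSubordinate (X := Y) isClosed_univ
    (fun i : t => {s : Y | ‖Φ s - Φ i‖ < η / 4})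
    (fun t => isOpen_lt (by fun_prop) continuous_const)
    (fun s hs => by
      obtain ⟨i, hi, his⟩ := Set.mem_iUnion₂.1 (ht hs)
      exact Set.mem_iUnion.2 ⟨⟨i, hi⟩, his⟩)
  have hp1 : ∀ y, ∑ i, p i y = 1 := fun y => by
    rw [← finsum_eq_sum_of_fintype]; exact p.sum_eq_one (Set.mem_univ y)
  refine ⟨t, fun i => p i, fun i y => p.nonneg i y, hp1, ?_⟩
  let k : t → C(Y, ℂ) := fun i => (p i).complexify
  have hk1 : ∀ y, ∑ i, ‖k i y‖ ≤ 1 := fun y => by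
    rw [← hp1 y]
    refine Finset.sum_le_sum fun i _ => ?_
    change ‖(p i y : ℂ)‖ ≤ _
    rw [Complex.norm_real, Real.norm_of_nonneg (p.nonneg i y)]
  have hint : ∀ {f : Y → ℝ}, Continuous f → Integrable f ν := fun hf =>
    hf.integrable_of_hasCompactSupport (HasCompactSupport.of_compactSpace _)
  have hint' : ∀ {f : Y → ℂ}, Continuous f → Integrable f ν := fun hf =>
    hf.integrable_of_hasCompactSupport (HasCompactSupport.of_compactSpace _)
  -- Replacing F'(x, y) by its value `c` at the centre costs `η / 4` on the left and again on the
  -- right, weighted by the mass of `p i`.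
  have hmain : ∀ x i, ∫ y, ‖F' (x, y)‖ * p i y ∂ν ≤
      ‖fiberIntegralₗ ν (k i) F' x‖ + η / 2 * ∫ y, p i y ∂ν := fun x i => by
    set c := F' (x, (i : Y)) with hc
    have hm : 0 ≤ ∫ y, p i y ∂ν := integral_nonneg fun y => p.nonneg i y
    have h0 : ∀ y, p i y ≠ 0 → ‖F' (x, y) - c‖ ≤ η / 4 := fun y hy => by
      have h1 : ‖Φ y - Φ i‖ < η / 4 := hp i (subset_closure hy)
      exact ((Φ y - Φ i).norm_coe_le_norm x).trans h1.le
    have h1 : ∫ y, ‖F' (x, y)‖ * p i y ∂ν ≤ ∫ y, (‖c‖ + η / 4) * p i y ∂ν := by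
      refine integral_mono (hint (by fun_prop)) (hint (by fun_prop)) fun y => ?_
      dsimp only
      by_cases hy : p i y = 0
      · simp [hy]
      · refine mul_le_mul_of_nonneg_right ?_ (p.nonneg i y)
        linarith [norm_le_norm_add_norm_sub' (F' (x, y)) c, h0 y hy]
    have h2 : ‖∫ y, (F' (x, y) - c) * (p i y : ℂ) ∂ν‖ ≤ ∫ y, η / 4 * p i y ∂ν := by
      refine norm_integral_le_of_norm_le (hint (by fun_prop)) (Eventually.of_forall fun y => ?_)
      rw [norm_mul, Complex.norm_real, Real.norm_of_nonneg (p.nonneg i y)]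
      by_cases hy : p i y = 0
      · simp [hy]
      · exact mul_le_mul_of_nonneg_right (h0 y hy) (p.nonneg i y)
    have h3 : ∫ y, (F' (x, y) - c) * (p i y : ℂ) ∂ν =
        fiberIntegralₗ ν (k i) F' x - c * (∫ y, p i y ∂ν : ℝ) := by
      simp only [sub_mul]
      rw [integral_sub (hint' (by fun_prop)) (hint' (by fun_prop)), integral_const_mul,
        integral_complex_ofReal]
      rfl
    have h4 : ‖c‖ * ∫ y, p i y ∂ν ≤ ‖fiberIntegralₗ ν (k i) F' x‖ + η / 4 * ∫ y, p i y ∂ν := by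
      rw [h3, integral_const_mul] at h2
      have h5 := norm_le_norm_add_norm_sub (fiberIntegralₗ ν (k i) F' x)
        (c * (∫ y, p i y ∂ν : ℝ))
      rw [norm_mul, Complex.norm_real, Real.norm_of_nonneg hm] at h5
      linarith
    rw [integral_const_mul] at h1
    linarith
  have hsum : ‖ContinuousMap.toLp 1 ρ ℂ F'‖ ≤
      ∑ i, ‖fiberIntegral μ ν ρ (k i) (ContinuousMap.toLp 1 ρ ℂ F')‖ + η / 2 := by
    simp only [fiberIntegral_toLp h, ContinuousMap.norm_toLp_one μ]
    have hi : ∀ i, Integrable (fun x => ‖fiberIntegralₗ ν (k i) F' x‖) μ := fun i =>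
      ((fiberIntegralₗ ν (k i) F').integrable_of_compactSpace μ).norm
    rw [h.norm_toLp, ← integral_finsetSum _ fun i _ => hi i]
    have h2 : ∫ x, (∑ i, ‖fiberIntegralₗ ν (k i) F' x‖ + η / 2) ∂μ =
        ∫ x, ∑ i, ‖fiberIntegralₗ ν (k i) F' x‖ ∂μ + η / 2 := by
      rw [integral_add (integrable_finsetSum _ fun i _ => hi i) (integrable_const _)]
      simp
    rw [← h2]
    refine integral_mono ((continuous_integral_norm F').integrable_of_hasCompactSupport
      (HasCompactSupport.of_compactSpace _))
      ((integrable_finsetSum _ fun i _ => hi i).add (integrable_const _)) fun x => ?_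
    dsimp only
    have h3 : ∫ y, ‖F' (x, y)‖ ∂ν = ∑ i, ∫ y, ‖F' (x, y)‖ * p i y ∂ν := by
      rw [← integral_finsetSum _ fun i _ => hint (by fun_prop)]
      simp only [← Finset.mul_sum, hp1, mul_one]
    have h4 : ∑ i, ∫ y, p i y ∂ν = 1 := by
      rw [← integral_finsetSum _ fun i _ => hint (by fun_prop)]
      simp only [hp1]
      simp
    rw [h3]
    refine (Finset.sum_le_sum fun i _ => hmain x i).trans_eq ?_
    rw [Finset.sum_add_distrib, ← Finset.mul_sum, h4, mul_one]
  -- Passing from `F'` back to `F` costs `η / 4` in the norm and `η / 4` in the sum.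
  have h5 := sum_norm_fiberIntegral_le h Finset.univ k hk1 (ContinuousMap.toLp 1 ρ ℂ F' - F)
  have h6 : ∑ i, ‖fiberIntegral μ ν ρ (k i) (ContinuousMap.toLp 1 ρ ℂ F')‖ ≤
      ∑ i, ‖fiberIntegral μ ν ρ (k i) F‖ +
        ∑ i, ‖fiberIntegral μ ν ρ (k i) (ContinuousMap.toLp 1 ρ ℂ F' - F)‖ := by
    rw [← Finset.sum_add_distrib]
    refine Finset.sum_le_sum fun i _ => ?_
    rw [map_sub]
    exact norm_le_norm_add_norm_sub' _ _
  rw [dist_eq_norm] at hF'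
  have h7 := norm_le_norm_add_norm_sub' F (ContinuousMap.toLp 1 ρ ℂ F')
  rw [norm_sub_rev _ F] at h5
  linarith

end ProductIntegral

/-! ### Multiplication operators on L¹ -/

section BoundedMultiplication

open Filter

variable {X : Type*} [MeasurableSpace X] {μ : Measure X}

/-- Multiplication by a bounded measurable function on `L¹`. -/
noncomputable def l1Mul (g : X → ℂ) (hg : Measurable g) (C : ℝ) (hC : ∀ x, ‖g x‖ ≤ C) :
    Lp ℂ 1 μ →L[ℂ] Lp ℂ 1 μ :=
  have hi : ∀ f : Lp ℂ 1 μ, Integrable (fun x => g x * f x) μ := fun f =>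
    (L1.integrable_coeFn f).bdd_mul hg.aestronglyMeasurable (Eventually.of_forall hC)
  LinearMap.mkContinuous
    { toFun := fun f => (hi f).toL1 _
      map_add' := fun f h => by
        refine Lp.ext ?_
        filter_upwards [(hi (f + h)).coeFn_toL1, (hi f).coeFn_toL1, (hi h).coeFn_toL1,
          Lp.coeFn_add f h, Lp.coeFn_add ((hi f).toL1 _) ((hi h).toL1 _)] with x h1 h2 h3 h4 h5
        rw [h1, h5, Pi.add_apply, h2, h3, h4, Pi.add_apply, mul_add]
      map_smul' := fun c f => by
        refine Lp.ext ?_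
        filter_upwards [(hi (c • f)).coeFn_toL1, (hi f).coeFn_toL1,
          Lp.coeFn_smul c f, Lp.coeFn_smul c ((hi f).toL1 _)] with x h1 h2 h3 h4
        rw [h1, RingHom.id_apply, h4, Pi.smul_apply, h2, h3, Pi.smul_apply, smul_eq_mul,
          smul_eq_mul, mul_left_comm] } C fun f => by
    simp only [LinearMap.coe_mk, AddHom.coe_mk]
    rw [L1.norm_of_fun_eq_integral_norm, L1.norm_eq_integral_norm, ← integral_const_mul]
    refine integral_mono (hi f).norm ((L1.integrable_coeFn f).norm.const_mul C) fun x => ?_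
    dsimp only
    rw [norm_mul]
    exact mul_le_mul_of_nonneg_right (hC x) (norm_nonneg _)

theorem coeFn_l1Mul (g : X → ℂ) (hg : Measurable g) (C : ℝ) (hC : ∀ x, ‖g x‖ ≤ C)
    (f : Lp ℂ 1 μ) : l1Mul g hg C hC f =ᵐ[μ] fun x => g x * f x :=
  Integrable.coeFn_toL1 ((L1.integrable_coeFn f).bdd_mul hg.aestronglyMeasurable
    (Eventually.of_forall hC))

end BoundedMultiplication

/-! ### The dual of L¹ of a probability space -/

section L1Dual

open Filter

variable {X : Type*} [MeasurableSpace X] {μ : Measure X} [IsProbabilityMeasure μ]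

variable (μ) in
/-- The inclusion of `L²` in `L¹` for a probability measure. -/
noncomputable def l2ToL1 : Lp ℂ 2 μ →L[ℂ] Lp ℂ 1 μ :=
  have hi : ∀ f : Lp ℂ 2 μ, MemLp f 1 μ := fun f => (Lp.memLp f).mono_exponent one_le_two
  LinearMap.mkContinuous
    { toFun := fun f => (hi f).toLp
      map_add' := fun f h => by
        refine Lp.ext ?_
        filter_upwards [(hi (f + h)).coeFn_toLp, (hi f).coeFn_toLp, (hi h).coeFn_toLp,
          Lp.coeFn_add f h, Lp.coeFn_add (hi f).toLp (hi h).toLp] with x h1 h2 h3 h4 h5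
        rw [h1, h5, Pi.add_apply, h2, h3, h4, Pi.add_apply]
      map_smul' := fun c f => by
        refine Lp.ext ?_
        filter_upwards [(hi (c • f)).coeFn_toLp, (hi f).coeFn_toLp,
          Lp.coeFn_smul c f, Lp.coeFn_smul c (hi f).toLp] with x h1 h2 h3 h4
        rw [h1, RingHom.id_apply, h4, Pi.smul_apply, h2, h3, Pi.smul_apply] } 1 fun f => by
    rw [one_mul, LinearMap.coe_mk, AddHom.coe_mk, Lp.norm_toLp, Lp.norm_def]
    exact ENNReal.toReal_mono (Lp.eLpNorm_ne_top f)
      (eLpNorm_le_eLpNorm_of_exponent_le one_le_two (Lp.aestronglyMeasurable f))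

theorem coeFn_l2ToL1 (f : Lp ℂ 2 μ) : l2ToL1 μ f =ᵐ[μ] f :=
  MemLp.coeFn_toLp ((Lp.memLp f).mono_exponent one_le_two)

/-- Every functional on `L¹` is integration against a bounded measurable function. -/
theorem exists_eq_integral_mul (φ : Lp ℂ 1 μ →L[ℂ] ℂ) :
    ∃ ψ : X → ℂ, Measurable ψ ∧ (∀ x, ‖ψ x‖ ≤ ‖φ‖) ∧ ∀ f, φ f = ∫ x, ψ x * f x ∂μ := by
  -- Riesz representation on L², which embeds in L¹ because the measure is finite.
  let G : Lp ℂ 2 μ := (InnerProductSpace.toDual ℂ (Lp ℂ 2 μ)).symm (φ.comp (l2ToL1 μ))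
  have hG : ∀ f : Lp ℂ 2 μ, φ (l2ToL1 μ f) = ∫ x, conj (G x) * f x ∂μ := fun f => by
    have h : inner ℂ G f = φ (l2ToL1 μ f) := InnerProductSpace.toDual_symm_apply
    rw [← h, L2.inner_def]
    refine integral_congr_ae (Eventually.of_forall fun x => ?_)
    dsimp only
    rw [RCLike.inner_apply, mul_comm]
  obtain ⟨g, hgm, hg⟩ : ∃ g : X → ℂ, Measurable g ∧ G =ᵐ[μ] g :=
    ⟨_, (Lp.stronglyMeasurable G).measurable, EventuallyEq.rfl⟩
  have hgi : Integrable g μ :=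
    ((memLp_congr_ae hg).1 (Lp.memLp G)).integrable one_le_two
  set A : Set X := {x | ‖φ‖ < ‖g x‖} with hA
  have hAm : MeasurableSet A := measurableSet_lt measurable_const hgm.norm
  have hAnull : μ A = 0 := by
    -- Testing with the phase of `g` on `A` gives ∫_A |g| ≤ ‖φ‖ μ(A), while |g| > ‖φ‖ on `A`; hence
    -- `A` is null.
    let f : X → ℂ := A.indicator fun x => g x / ‖g x‖
    have hfm : Measurable f := (hgm.div (by fun_prop)).indicator hAm
    have hfx : ∀ x, ‖f x‖ = A.indicator 1 x := fun x => by
      by_cases hx : x ∈ A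
      · have : 0 < ‖g x‖ := (norm_nonneg φ).trans_lt hx
        simp [f, hx, this.ne']
      · simp [f, hx]
    have hf2 : MemLp f 2 μ := MemLp.of_bound hfm.aestronglyMeasurable 1
      (Eventually.of_forall fun x => by
        rw [hfx]; exact Set.indicator_le_self' (fun _ _ => zero_le_one) x)
    have h1 : φ (l2ToL1 μ (hf2.toLp f)) = (∫ x, A.indicator (fun x => ‖g x‖) x ∂μ : ℝ) := by
      rw [hG, ← integral_complex_ofReal]
      refine integral_congr_ae ?_
      filter_upwards [hf2.coeFn_toLp, hg] with x hx hx'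
      rw [hx, hx']
      by_cases hxA : x ∈ A
      · have : 0 < ‖g x‖ := (norm_nonneg φ).trans_lt hxA
        simp only [f, hxA, Set.indicator_of_mem]
        rw [mul_div_assoc', ← Complex.normSq_eq_conj_mul_self, Complex.normSq_eq_norm_sq]
        push_cast
        rw [sq, mul_div_assoc, div_self (by exact_mod_cast this.ne'), mul_one]
      · simp [f, hxA]
    have h2 : ‖l2ToL1 μ (hf2.toLp f)‖ = ∫ x, A.indicator (1 : X → ℝ) x ∂μ := by
      rw [L1.norm_eq_integral_norm]
      refine integral_congr_ae ?_
      filter_upwards [coeFn_l2ToL1 (hf2.toLp f), hf2.coeFn_toLp] with x hx hx'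
      rw [hx, hx', hfx]
    have h3 := φ.le_opNorm (l2ToL1 μ (hf2.toLp f))
    have hi1 : Integrable (A.indicator fun x => ‖g x‖) μ := hgi.norm.indicator hAm
    have hi2 : Integrable (fun x => ‖φ‖ * A.indicator (1 : X → ℝ) x) μ :=
      ((integrable_const (1 : ℝ)).indicator hAm).const_mul _
    rw [h1, h2, Complex.norm_real, Real.norm_of_nonneg
      (integral_nonneg fun x => Set.indicator_nonneg (fun _ _ => norm_nonneg _) x),
      ← integral_const_mul, ← sub_nonpos, ← integral_sub hi1 hi2] at h3
    have h4 : 0 ≤ fun x => A.indicator (fun x => ‖g x‖) x - ‖φ‖ * A.indicator (1 : X → ℝ) x :=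
      fun x => by
        by_cases hx : x ∈ A
        · simpa [hx] using (le_of_lt hx : ‖φ‖ ≤ ‖g x‖)
        · simp [hx]
    have h5 := (integral_eq_zero_iff_of_nonneg h4 (hi1.sub hi2)).1
      (le_antisymm h3 (integral_nonneg h4))
    refine measure_mono_null (fun x hx => ?_) h5
    have : ‖φ‖ < ‖g x‖ := hx
    simp [hx, sub_eq_zero, this.ne']
  -- Setting the density to zero on the null set `A` makes the bound hold everywhere.
  let ψ : X → ℂ := Aᶜ.indicator fun x => conj (g x)
  have hψm : Measurable ψ := (Complex.continuous_conj.measurable.comp hgm).indicator hAm.compl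
  have hψb : ∀ x, ‖ψ x‖ ≤ ‖φ‖ := fun x => by
    by_cases hx : x ∈ A
    · simp [ψ, hx]
    · simpa [ψ, hx] using not_lt.1 hx
  refine ⟨ψ, hψm, hψb, fun f => ?_⟩
  change φ f = l1Pairing ψ hψm _ hψb f
  refine Lp.induction ENNReal.one_ne_top (motive := fun f => φ f = l1Pairing ψ hψm _ hψb f)
    (fun c s hs hμs => ?_) (fun f h hf hh _ h1 h2 => ?_)
    (isClosed_eq (by fun_prop) (by fun_prop)) f
  · have h2 : MemLp (s.indicator fun _ => c) 2 μ := memLp_indicator_const 2 hs c (Or.inr hμs.ne)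
    have h1 : (Lp.simpleFunc.indicatorConst 1 hs hμs.ne c : Lp ℂ 1 μ) =
        l2ToL1 μ (h2.toLp _) := by
      refine Lp.ext ?_
      rw [Lp.simpleFunc.coe_indicatorConst]
      filter_upwards [indicatorConstLp_coeFn (p := 1) (hs := hs) (hμs := hμs.ne) (c := c),
        coeFn_l2ToL1 (h2.toLp _), h2.coeFn_toLp] with x hx hx' hx''
      rw [hx, hx', hx'']
    rw [h1, hG, l1Pairing_apply]
    refine integral_congr_ae ?_
    filter_upwards [coeFn_l2ToL1 (h2.toLp _), hg, compl_mem_ae_iff.2 hAnull] with x hx hx' hxA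
    rw [hx, hx', show ψ x = conj (g x) from Set.indicator_of_mem hxA _]
  · rw [map_add, map_add, h1, h2]

end L1Dual

/-! ### From peaks to the narrowness condition -/

section Peaks

open Filter

variable {X : Type*} [MeasurableSpace X] {μ : Measure X} [IsProbabilityMeasure μ]
  {E : Type*} [NormedAddCommGroup E] [NormedSpace ℂ E]

/-- Up to small `T`-error, every normalized function `γ 1_A / μ A` can be replaced by an almost
normalized function that is concentrated on `A`, has argument close to that of `γ`, and is almost
`ℓ¹`-orthogonal to a given function. -/
def HasPeaks (T : Lp ℂ 1 μ →L[ℂ] E) (γ : X → ℂ) : Prop :=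
  ∀ A, MeasurableSet A → μ A ≠ 0 → ∀ y : Lp ℂ 1 μ,
    y =ᵐ[μ] (fun x => ((μ.real A)⁻¹ : ℂ) * A.indicator γ x) → ∀ x : Lp ℂ 1 μ, ‖x‖ = 1 →
      ∀ δ : ℝ, 0 < δ → ∃ z : Lp ℂ 1 μ, ‖z‖ ≤ 1 + δ ∧ ‖T (y - z)‖ ≤ δ ∧
        ∫ t in Aᶜ, ‖z t‖ ∂μ ≤ δ ∧ ‖∫ t, conj (γ t) * z t ∂μ - 1‖ ≤ δ ∧ 2 - δ ≤ ‖x + z‖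

/-- `y` can be replaced, up to small error for `T` and relative error `ε` for `φ`, by an element of
almost the same norm that is almost `ℓ¹`-orthogonal to a given one. -/
def IsReplaceable {V : Type*} [NormedAddCommGroup V] [NormedSpace ℂ V] (T : V →L[ℂ] E)
    (φ : V →L[ℂ] ℂ) (ε : ℝ) (y : V) : Prop :=
  ∀ (x : V) (δ : ℝ), 0 < δ → ∃ z, ‖z‖ ≤ ‖y‖ + δ ∧ ‖T (y - z)‖ ≤ δ ∧
    ‖φ (y - z)‖ ≤ ε * ‖y‖ + δ ∧ ‖x‖ + ‖y‖ - δ ≤ ‖x + z‖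

namespace IsReplaceable

variable {V : Type*} [NormedAddCommGroup V] [NormedSpace ℂ V] {T : V →L[ℂ] E}
  {φ : V →L[ℂ] ℂ} {ε : ℝ}

theorem zero : IsReplaceable T φ ε 0 := fun x δ hδ =>
  ⟨0, by simpa using hδ.le, by simpa using hδ.le, by simpa using hδ.le, by simpa using hδ.le⟩

theorem smul {y : V} (hy : IsReplaceable T φ ε y) (c : ℂ) : IsReplaceable T φ ε (c • y) := by
  rcases eq_or_ne c 0 with rfl | hc
  · rw [zero_smul]; exact zero
  intro x δ hδ
  have hc' : 0 < ‖c‖ := norm_pos_iff.2 hc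
  obtain ⟨z, h1, h2, h3, h4⟩ := hy (c⁻¹ • x) (δ / ‖c‖) (by positivity)
  have hδc : ‖c‖ * (δ / ‖c‖) = δ := by field_simp
  refine ⟨c • z, ?_, ?_, ?_, ?_⟩
  · rw [norm_smul, norm_smul]
    calc ‖c‖ * ‖z‖ ≤ ‖c‖ * (‖y‖ + δ / ‖c‖) := by gcongr
      _ = _ := by rw [mul_add, hδc]
  · rw [← smul_sub, map_smul, norm_smul]
    calc ‖c‖ * ‖T (y - z)‖ ≤ ‖c‖ * (δ / ‖c‖) := by gcongr
      _ = _ := hδc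
  · rw [← smul_sub, map_smul, norm_smul, norm_smul]
    calc ‖c‖ * ‖φ (y - z)‖ ≤ ‖c‖ * (ε * ‖y‖ + δ / ‖c‖) := by gcongr
      _ = _ := by rw [mul_add, hδc]; ring
  · have h5 : x + c • z = c • (c⁻¹ • x + z) := by rw [smul_add, smul_inv_smul₀ hc]
    rw [h5, norm_smul, norm_smul]
    calc ‖x‖ + ‖c‖ * ‖y‖ - δ = ‖c‖ * (‖c⁻¹ • x‖ + ‖y‖ - δ / ‖c‖) := by
          rw [norm_smul, norm_inv, mul_sub, hδc, mul_add, mul_inv_cancel_left₀ hc'.ne']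
      _ ≤ _ := by gcongr

/-- The second replacement is chosen almost orthogonal to `x + z₁`, so the norms keep adding. The
error for `φ` is relative to the norm, hence additive exactly when ‖y₁ + y₂‖ splits. -/
theorem add {y₁ y₂ : V} (h₁ : IsReplaceable T φ ε y₁) (h₂ : IsReplaceable T φ ε y₂)
    (h : ‖y₁ + y₂‖ = ‖y₁‖ + ‖y₂‖) : IsReplaceable T φ ε (y₁ + y₂) := by
  intro x δ hδ
  obtain ⟨z₁, a1, a2, a3, a4⟩ := h₁ x (δ / 2) (by positivity)
  obtain ⟨z₂, b1, b2, b3, b4⟩ := h₂ (x + z₁) (δ / 2) (by positivity)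
  refine ⟨z₁ + z₂, ?_, ?_, ?_, ?_⟩
  · linarith [norm_add_le z₁ z₂]
  · rw [add_sub_add_comm, map_add]
    linarith [norm_add_le (T (y₁ - z₁)) (T (y₂ - z₂))]
  · rw [add_sub_add_comm, map_add, h, mul_add]
    linarith [norm_add_le (φ (y₁ - z₁)) (φ (y₂ - z₂))]
  · rw [← add_assoc]
    linarith

theorem isClosed_setOf (hε : 0 ≤ ε) : IsClosed {y | IsReplaceable T φ ε y} := by
  refine isClosed_of_closure_subset fun y hy x δ hδ => ?_
  set K : ℝ := 1 + ‖T‖ + ‖φ‖ + ε with hK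
  have hK0 : 0 < K := by positivity
  set r : ℝ := δ / (2 * K) with hr
  have hr0 : 0 < r := by positivity
  have hKr : K * r = δ / 2 := by rw [hr]; field_simp
  obtain ⟨y', hy', hd⟩ := Metric.mem_closure_iff.1 hy r hr0
  rw [dist_eq_norm] at hd
  obtain ⟨z, h1, h2, h3, h4⟩ := hy' x (δ / 2) (by positivity)
  have hT : 0 ≤ ‖T‖ * r := by positivity
  have hφ : 0 ≤ ‖φ‖ * r := by positivity
  have hεr : 0 ≤ ε * r := by positivity
  have hsum : r + ‖T‖ * r + ‖φ‖ * r + ε * r = δ / 2 := by rw [← hKr, hK]; ring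
  have hn1 : ‖y'‖ ≤ ‖y‖ + r := by linarith [norm_le_norm_add_norm_sub y y']
  have hn2 : ‖y‖ ≤ ‖y'‖ + r := by linarith [norm_le_norm_add_norm_sub' y y']
  have hsplit : y - z = (y - y') + (y' - z) := by abel
  refine ⟨z, by linarith, ?_, ?_, by linarith⟩
  · rw [hsplit, map_add]
    have h5 : ‖T (y - y')‖ ≤ ‖T‖ * r := (T.le_opNorm _).trans (by gcongr)
    linarith [norm_add_le (T (y - y')) (T (y' - z))]
  · rw [hsplit, map_add]
    have h5 : ‖φ (y - y')‖ ≤ ‖φ‖ * r := (φ.le_opNorm _).trans (by gcongr)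
    have h6 : ε * ‖y'‖ ≤ ε * ‖y‖ + ε * r := by rw [← mul_add]; gcongr
    linarith [norm_add_le (φ (y - y')) (φ (y' - z))]

end IsReplaceable

/-- Almost ℓ¹-orthogonality to a unit vector passes to its multiples: subtract the surplus of `x` if
α ≤ 1, or of `z` if α ≥ 1, by the triangle inequality. -/
theorem le_norm_smul_add {V : Type*} [NormedAddCommGroup V] [NormedSpace ℂ V] {x z : V} {δ α : ℝ}
    (hα : 0 ≤ α) (hδ : 0 ≤ δ) (hx : ‖x‖ = 1) (hz : ‖z‖ ≤ 1 + δ) (h : 2 - δ ≤ ‖x + z‖) :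
    α + 1 - (2 * α + 1) * δ ≤ ‖(α : ℂ) • x + z‖ := by
  rcases le_total α 1 with h1 | h1
  · have h2 : x + z = ((α : ℂ) • x + z) + ((1 - α : ℝ) : ℂ) • x := by
      push_cast; module
    have h3 := norm_add_le ((α : ℂ) • x + z) (((1 - α : ℝ) : ℂ) • x)
    rw [← h2, norm_smul, Complex.norm_real, Real.norm_of_nonneg (by linarith), hx] at h3
    nlinarith
  · have h2 : (α : ℂ) • (x + z) = ((α : ℂ) • x + z) + ((α - 1 : ℝ) : ℂ) • z := by
      push_cast; module
    have h3 := norm_add_le ((α : ℂ) • x + z) (((α - 1 : ℝ) : ℂ) • z)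
    rw [← h2, norm_smul, norm_smul, Complex.norm_real, Complex.norm_real,
      Real.norm_of_nonneg (by linarith), Real.norm_of_nonneg (by linarith : 0 ≤ α - 1)] at h3
    nlinarith

variable {T : Lp ℂ 1 μ →L[ℂ] E} {γ : X → ℂ}

theorem norm_eq_one_of_ae_eq (hγ1 : ∀ x, ‖γ x‖ = 1) {A : Set X}
    (hA : MeasurableSet A) (hA0 : μ A ≠ 0) {y : Lp ℂ 1 μ}
    (hy : y =ᵐ[μ] fun x => ((μ.real A)⁻¹ : ℂ) * A.indicator γ x) : ‖y‖ = 1 := by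
  have hpos : 0 < μ.real A := ENNReal.toReal_pos hA0 (measure_ne_top μ A)
  rw [L1.norm_eq_integral_norm]
  have h : ∫ x, ‖y x‖ ∂μ = ∫ x, A.indicator (fun _ => (μ.real A)⁻¹) x ∂μ := by
    refine integral_congr_ae ?_
    filter_upwards [hy] with x hx
    rw [hx]
    by_cases hxA : x ∈ A
    · simp [hxA, hγ1]
    · simp [hxA]
  rw [h, integral_indicator_const _ hA, smul_eq_mul, mul_inv_cancel₀ hpos.ne']

theorem integral_conj_mul_eq_one (hγ1 : ∀ x, ‖γ x‖ = 1) {A : Set X}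
    (hA : MeasurableSet A) (hA0 : μ A ≠ 0) {y : Lp ℂ 1 μ}
    (hy : y =ᵐ[μ] fun x => ((μ.real A)⁻¹ : ℂ) * A.indicator γ x) :
    ∫ x, conj (γ x) * y x ∂μ = 1 := by
  have hpos : 0 < μ.real A := ENNReal.toReal_pos hA0 (measure_ne_top μ A)
  have h : ∫ x, conj (γ x) * y x ∂μ = ∫ x, A.indicator (fun _ => ((μ.real A)⁻¹ : ℂ)) x ∂μ := by
    refine integral_congr_ae ?_
    filter_upwards [hy] with x hx
    rw [hx]
    by_cases hxA : x ∈ A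
    · have : conj (γ x) * γ x = 1 := by
        rw [← Complex.normSq_eq_conj_mul_self, Complex.normSq_eq_norm_sq, hγ1]; simp
      simp only [hxA, Set.indicator_of_mem]
      rw [mul_left_comm, this, mul_one]
    · simp [hxA]
  rw [h, integral_indicator_const _ hA, Complex.real_smul, mul_inv_cancel₀]
  exact_mod_cast hpos.ne'

/-- Near `A` the functional is `c` times the pairing with `conj γ`, and a peak preserves that
pairing up to a small error. The remainder is at most `ε / 2` on `A`, where `y` and the peak each
have norm about one; off `A` the peak has little mass. -/
theorem HasPeaks.isReplaceable_of_near_const (hT : HasPeaks T γ) (hγ : Measurable γ)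
    (hγ1 : ∀ x, ‖γ x‖ = 1) {φ : Lp ℂ 1 μ →L[ℂ] ℂ} {ψ : X → ℂ} (hψ : Measurable ψ) {M : ℝ}
    (hψM : ∀ x, ‖ψ x‖ ≤ M) (hφ : ∀ f, φ f = ∫ x, ψ x * f x ∂μ) {ε : ℝ} (hε : 0 ≤ ε)
    {A : Set X} (hA : MeasurableSet A) (hA0 : μ A ≠ 0) {c : ℂ}
    (hc : ∀ x ∈ A, ‖ψ x * γ x - c‖ ≤ ε / 2) {y : Lp ℂ 1 μ}
    (hy : y =ᵐ[μ] fun x => ((μ.real A)⁻¹ : ℂ) * A.indicator γ x) : IsReplaceable T φ ε y := by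
  intro x δ hδ
  have hy1 := norm_eq_one_of_ae_eq hγ1 hA hA0 hy
  obtain ⟨x', hx'1, hx'⟩ : ∃ x' : Lp ℂ 1 μ, ‖x'‖ = 1 ∧ x = (‖x‖ : ℂ) • x' := by
    rcases eq_or_ne x 0 with rfl | hx
    · exact ⟨y, hy1, by simp⟩
    · have hx0 : (‖x‖ : ℂ) ≠ 0 := by exact_mod_cast norm_ne_zero_iff.2 hx
      exact ⟨(‖x‖ : ℂ)⁻¹ • x, by rw [norm_smul, norm_inv, Complex.norm_real, norm_norm,
        inv_mul_cancel₀ (norm_ne_zero_iff.2 hx)], (smul_inv_smul₀ hx0 x).symm⟩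
  obtain ⟨p⟩ : Nonempty X := by
    by_contra h
    rw [not_nonempty_iff] at h
    exact hA0 (by rw [Set.eq_empty_of_isEmpty A, measure_empty])
  have hM : 0 ≤ M := (norm_nonneg _).trans (hψM p)
  -- The sum of the coefficients that bound all the errors arising when `hT` is applied with
  -- tolerance `r`.
  set K : ℝ := 1 + ε + M + 2 * ‖c‖ + 2 * ‖x‖ with hK
  have hK0 : 0 < K := by positivity
  set r : ℝ := δ / K with hr
  have hr0 : 0 < r := by positivity
  have hKr : K * r = δ := by rw [hr]; field_simp
  have hexp : r + ε * r + M * r + 2 * (‖c‖ * r) + 2 * (‖x‖ * r) = δ := by rw [← hKr, hK]; ring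
  have e1 : 0 ≤ ε * r := by positivity
  have e2 : 0 ≤ M * r := by positivity
  have e3 : 0 ≤ ‖c‖ * r := by positivity
  have e4 : 0 ≤ ‖x‖ * r := by positivity
  obtain ⟨z, h1, h2, h3, h4, h5⟩ := hT A hA hA0 y hy x' hx'1 r hr0
  refine ⟨z, by linarith, by linarith, ?_, ?_⟩
  · let κ : X → ℂ := fun t => ψ t - c * conj (γ t)
    have hκm : Measurable κ :=
      hψ.sub ((Complex.continuous_conj.measurable.comp hγ).const_mul c)
    have hκb : ∀ t, ‖κ t‖ ≤ M + ‖c‖ := fun t => by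
      refine (norm_sub_le _ _).trans ?_
      rw [norm_mul, RCLike.norm_conj, hγ1, mul_one]
      linarith [hψM t]
    have hκA : ∀ t ∈ A, ‖κ t‖ ≤ ε / 2 := fun t ht => by
      have h6 : κ t * γ t = ψ t * γ t - c := by
        have : conj (γ t) * γ t = 1 := by
          rw [← Complex.normSq_eq_conj_mul_self, Complex.normSq_eq_norm_sq, hγ1]; simp
        simp only [κ]
        linear_combination -c * this
      have h7 := hc t ht
      rwa [← h6, norm_mul, hγ1, mul_one] at h7
    have hγm : Measurable fun t => conj (γ t) := Complex.continuous_conj.measurable.comp hγ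
    have hγb : ∀ t, ‖conj (γ t)‖ ≤ 1 := fun t => by rw [RCLike.norm_conj, hγ1]
    have hdec : φ (y - z) = c * (1 - ∫ t, conj (γ t) * z t ∂μ) +
        ∫ t, κ t * (y - z : Lp ℂ 1 μ) t ∂μ := by
      have h8 : φ (y - z) = c * l1Pairing (μ := μ) _ hγm 1 hγb (y - z) +
          l1Pairing κ hκm _ hκb (y - z) := by
        rw [hφ, l1Pairing_apply, l1Pairing_apply, ← integral_const_mul, ← integral_add]
        · refine integral_congr_ae (Eventually.of_forall fun t => ?_)
          simp only [κ]
          ring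
        · exact ((L1.integrable_coeFn (y - z)).bdd_mul hγm.aestronglyMeasurable
            (Eventually.of_forall hγb)).const_mul c
        · exact (L1.integrable_coeFn (y - z)).bdd_mul hκm.aestronglyMeasurable
            (Eventually.of_forall hκb)
      rw [map_sub (l1Pairing (μ := μ) _ hγm 1 hγb), l1Pairing_apply, l1Pairing_apply,
        l1Pairing_apply, integral_conj_mul_eq_one hγ1 hA hA0 hy] at h8
      exact h8
    have hzi := (L1.integrable_coeFn z).norm
    have hyi' : Integrable (fun t => ε / 2 * ‖y t‖) μ := (L1.integrable_coeFn y).norm.const_mul _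
    have hzi' : Integrable (fun t => ε / 2 * ‖z t‖) μ := hzi.const_mul _
    have hsum : Integrable (fun t => ε / 2 * ‖y t‖ + ε / 2 * ‖z t‖) μ := hyi'.add hzi'
    have hind : Integrable (Aᶜ.indicator fun t => (M + ‖c‖) * ‖z t‖) μ :=
      (hzi.const_mul _).indicator hA.compl
    have hbound : ‖∫ t, κ t * (y - z : Lp ℂ 1 μ) t ∂μ‖ ≤
        ∫ t, (ε / 2 * ‖y t‖ + ε / 2 * ‖z t‖ + Aᶜ.indicator (fun t => (M + ‖c‖) * ‖z t‖) t) ∂μ := by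
      refine norm_integral_le_of_norm_le (hsum.add hind) ?_
      filter_upwards [Lp.coeFn_sub y z, hy] with t ht hty
      rw [ht, Pi.sub_apply, norm_mul]
      by_cases htA : t ∈ A
      · simp only [Set.indicator_of_notMem (Set.notMem_compl_iff.2 htA), add_zero]
        rw [← mul_add]
        exact mul_le_mul (hκA t htA) (norm_sub_le _ _) (norm_nonneg _) (by positivity)
      · rw [Set.indicator_of_notMem htA, mul_zero] at hty
        rw [Set.indicator_of_mem (Set.mem_compl htA), hty, zero_sub, norm_neg]
        have : 0 ≤ ε / 2 * ‖(0 : ℂ)‖ + ε / 2 * ‖z t‖ := by positivity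
        have := mul_le_mul_of_nonneg_right (hκb t) (norm_nonneg (z t))
        linarith
    rw [integral_add hsum hind, integral_add hyi' hzi', integral_const_mul, integral_const_mul, integral_indicator hA.compl, integral_const_mul,
      ← L1.norm_eq_integral_norm, ← L1.norm_eq_integral_norm, hy1] at hbound
    have h9 : ‖c * (1 - ∫ t, conj (γ t) * z t ∂μ)‖ ≤ ‖c‖ * r := by
      rw [norm_mul, norm_sub_rev]; gcongr
    have h10 : (M + ‖c‖) * ∫ t in Aᶜ, ‖z t‖ ∂μ ≤ (M + ‖c‖) * r := by gcongr
    have h11 : ε / 2 * ‖z‖ ≤ ε / 2 * (1 + r) := by gcongr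
    rw [hdec, hy1]
    refine (norm_add_le _ _).trans ?_
    linarith
  · have h6 := le_norm_smul_add (norm_nonneg x) hr0.le hx'1 h1 h5
    rw [← hx'] at h6
    rw [hy1]
    linarith

/-- The values of ψγ lie in a compact disc, covered by finitely many discs of radius `ε / 2`.
Induction on the centres splits `A` into disjoint pieces on which ψγ is nearly constant, and norms
add over disjoint supports. -/
theorem HasPeaks.isReplaceable_indicator (hT : HasPeaks T γ) (hγ : Measurable γ)
    (hγ1 : ∀ x, ‖γ x‖ = 1) (φ : Lp ℂ 1 μ →L[ℂ] ℂ) {ε : ℝ} (hε : 0 < ε) {A : Set X}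
    (hA : MeasurableSet A) {y : Lp ℂ 1 μ} (hy : y =ᵐ[μ] A.indicator γ) :
    IsReplaceable T φ ε y := by
  obtain ⟨ψ, hψ, hψM, hφ⟩ := exists_eq_integral_mul φ
  have hκ : Measurable fun x => ψ x * γ x := hψ.mul hγ
  suffices h : ∀ (t : Finset ℂ) (A : Set X), MeasurableSet A →
      (∀ x ∈ A, ∃ c ∈ t, ‖ψ x * γ x - c‖ < ε / 2) → ∀ y : Lp ℂ 1 μ, y =ᵐ[μ] A.indicator γ →
      IsReplaceable T φ ε y by
    obtain ⟨t, -, ht⟩ := (isCompact_closedBall (0 : ℂ) ‖φ‖).elim_nhds_subcover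
      (fun c => Metric.ball c (ε / 2)) fun c _ => Metric.ball_mem_nhds c (half_pos hε)
    refine h t A hA (fun x _ => ?_) y hy
    have hx : ψ x * γ x ∈ Metric.closedBall (0 : ℂ) ‖φ‖ := by
      rw [mem_closedBall_zero_iff, norm_mul, hγ1, mul_one]; exact hψM x
    obtain ⟨c, hc, hxc⟩ := Set.mem_iUnion₂.1 (ht hx)
    exact ⟨c, hc, by rwa [mem_ball_iff_norm] at hxc⟩
  intro t
  induction t using Finset.induction_on with
  | empty =>
    intro A hA h y hy
    have hA0 : A = ∅ := Set.eq_empty_of_forall_notMem fun x hx => by simpa using h x hx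
    have : y = 0 := by
      refine Lp.ext (hy.trans ?_)
      rw [hA0, Set.indicator_empty]
      exact (Lp.coeFn_zero ℂ 1 μ).symm
    rw [this]
    exact .zero
  | insert c t _ ih =>
    intro A hA h y hy
    set B : Set X := A ∩ {x | ‖ψ x * γ x - c‖ < ε / 2} with hB
    have hBm : MeasurableSet B :=
      hA.inter (measurableSet_lt (hκ.sub_const c).norm measurable_const)
    have hi : ∀ {S : Set X}, MeasurableSet S → Integrable (S.indicator γ) μ := fun hS =>
      (Integrable.of_bound hγ.aestronglyMeasurable 1
        (Eventually.of_forall fun x => (hγ1 x).le)).indicator hS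
    have hdiff : IsReplaceable T φ ε ((hi (hA.diff hBm)).toL1 _) := by
      refine ih _ (hA.diff hBm) (fun x hx => ?_) _ (Integrable.coeFn_toL1 _)
      obtain ⟨d, hd, hxd⟩ := h x hx.1
      rcases Finset.mem_insert.1 hd with rfl | hd
      · exact absurd ⟨hx.1, hxd⟩ hx.2
      · exact ⟨d, hd, hxd⟩
    have hBr : IsReplaceable T φ ε ((hi hBm).toL1 _) := by
      rcases eq_or_ne (μ B) 0 with hB0 | hB0
      · have : (hi hBm).toL1 _ = 0 := by
          refine Lp.ext ((Integrable.coeFn_toL1 _).trans ?_)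
          refine EventuallyEq.trans ?_ (Lp.coeFn_zero ℂ 1 μ).symm
          exact indicator_meas_zero hB0
        rw [this]
        exact .zero
      · have hpos : (μ.real B : ℂ) ≠ 0 := by
          exact_mod_cast (ENNReal.toReal_pos hB0 (measure_ne_top μ B)).ne'
        have h1 := hT.isReplaceable_of_near_const hγ hγ1 hψ hψM hφ hε.le hBm hB0
          (c := c) (fun x hx => hx.2.le) (y := ((μ.real B : ℂ)⁻¹) • (hi hBm).toL1 _) (by
            filter_upwards [Lp.coeFn_smul ((μ.real B : ℂ)⁻¹) ((hi hBm).toL1 _),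
              (hi hBm).coeFn_toL1] with x hx hx'
            rw [hx, Pi.smul_apply, hx', smul_eq_mul])
        simpa only [smul_inv_smul₀ hpos] using h1.smul (μ.real B : ℂ)
    have hsplit : ∀ x, A.indicator γ x = B.indicator γ x + (A \ B).indicator γ x := fun x => by
      by_cases hxB : x ∈ B
      · rw [Set.indicator_of_mem hxB, Set.indicator_of_mem hxB.1,
          Set.indicator_of_notMem fun h : x ∈ A \ B => h.2 hxB, add_zero]
      · rw [Set.indicator_of_notMem hxB, zero_add]
        by_cases hxA : x ∈ A
        · rw [Set.indicator_of_mem hxA, Set.indicator_of_mem (s := A \ B) ⟨hxA, hxB⟩]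
        · rw [Set.indicator_of_notMem hxA, Set.indicator_of_notMem fun h : x ∈ A \ B => hxA h.1]
    have hys : y = (hi hBm).toL1 _ + (hi (hA.diff hBm)).toL1 _ := by
      refine Lp.ext ?_
      filter_upwards [hy, (hi hBm).coeFn_toL1, (hi (hA.diff hBm)).coeFn_toL1,
        Lp.coeFn_add ((hi hBm).toL1 _) ((hi (hA.diff hBm)).toL1 _)] with x h1 h2 h3 h4
      rw [h4, Pi.add_apply, h2, h3, h1, hsplit]
    have hnorm : ‖y‖ = ‖(hi hBm).toL1 _‖ + ‖(hi (hA.diff hBm)).toL1 _‖ := by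
      rw [L1.norm_of_fun_eq_integral_norm, L1.norm_of_fun_eq_integral_norm,
        L1.norm_eq_integral_norm, ← integral_add (hi hBm).norm (hi (hA.diff hBm)).norm]
      refine integral_congr_ae ?_
      filter_upwards [hy] with x hx
      rw [hx, hsplit]
      by_cases hxB : x ∈ B
      · rw [Set.indicator_of_notMem fun h : x ∈ A \ B => h.2 hxB, add_zero, norm_zero, add_zero]
      · rw [Set.indicator_of_notMem hxB, zero_add, norm_zero, zero_add]
    rw [hys] at hnorm ⊢
    exact hBr.add hdiff hnorm

theorem HasPeaks.isReplaceable (hT : HasPeaks T γ) (hγ : Measurable γ)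
    (hγ1 : ∀ x, ‖γ x‖ = 1) (φ : Lp ℂ 1 μ →L[ℂ] ℂ) {ε : ℝ} (hε : 0 < ε) (y : Lp ℂ 1 μ) :
    IsReplaceable T φ ε y := by
  -- Multiplication by γ is a surjective isometry of L¹, so it suffices to treat γ times a simple
  -- function and pass to the limit.
  let M : Lp ℂ 1 μ →L[ℂ] Lp ℂ 1 μ := l1Mul γ hγ 1 fun x => (hγ1 x).le
  have hM : ∀ f, M f =ᵐ[μ] fun x => γ x * f x := fun f => coeFn_l1Mul _ _ _ _ f
  have hMn : ∀ f, ‖M f‖ = ‖f‖ := fun f => by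
    rw [L1.norm_eq_integral_norm, L1.norm_eq_integral_norm]
    refine integral_congr_ae ?_
    filter_upwards [hM f] with x hx
    rw [hx, norm_mul, hγ1, one_mul]
  have hall : ∀ f, IsReplaceable T φ ε (M f) := fun f => by
    refine Lp.induction ENNReal.one_ne_top (motive := fun f => IsReplaceable T φ ε (M f))
      (fun c s hs hμs => ?_) (fun f h hf hh hd h1 h2 => ?_)
      ((IsReplaceable.isClosed_setOf hε.le).preimage M.continuous) f
    · have hi : Integrable (s.indicator γ) μ :=
        (Integrable.of_bound hγ.aestronglyMeasurable 1
          (Eventually.of_forall fun x => (hγ1 x).le)).indicator hs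
      have h1 : M (Lp.simpleFunc.indicatorConst 1 hs hμs.ne c : Lp ℂ 1 μ) = c • hi.toL1 _ := by
        rw [Lp.simpleFunc.coe_indicatorConst]
        refine Lp.ext ?_
        filter_upwards [hM (indicatorConstLp 1 hs hμs.ne c), Lp.coeFn_smul c (hi.toL1 _),
          hi.coeFn_toL1, indicatorConstLp_coeFn (p := 1) (hs := hs) (hμs := hμs.ne) (c := c)]
          with x h1 h2 h3 h4
        rw [h1, h2, Pi.smul_apply, h3, h4]
        by_cases hx : x ∈ s
        · simp [hx, mul_comm]
        · simp [hx]
      rw [h1]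
      exact (hT.isReplaceable_indicator hγ hγ1 φ hε hs hi.coeFn_toL1).smul c
    · rw [map_add]
      refine h1.add h2 ?_
      rw [← map_add, hMn, hMn, hMn, L1.norm_eq_integral_norm, L1.norm_eq_integral_norm,
        L1.norm_eq_integral_norm, ← integral_add (L1.integrable_coeFn _).norm
          (L1.integrable_coeFn _).norm]
      refine integral_congr_ae ?_
      filter_upwards [Lp.coeFn_add (hf.toLp f) (hh.toLp h), hf.coeFn_toLp, hh.coeFn_toLp]
        with x h3 h4 h5
      rw [h3, Pi.add_apply, h4, h5]
      by_cases hx : f x = 0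
      · simp [hx]
      · have : h x = 0 := by
          by_contra hx'
          exact Set.disjoint_left.1 hd hx hx'
        simp [this]
  have hγm : Measurable fun t => conj (γ t) := Complex.continuous_conj.measurable.comp hγ
  have hγb : ∀ t, ‖conj (γ t)‖ ≤ 1 := fun t => by rw [RCLike.norm_conj, hγ1]
  have hy : M (l1Mul _ hγm 1 hγb y) = y := by
    refine Lp.ext ?_
    filter_upwards [hM (l1Mul _ hγm 1 hγb y), coeFn_l1Mul _ hγm 1 hγb y] with x h1 h2
    have : γ x * conj (γ x) = 1 := by
      rw [Complex.mul_conj, Complex.normSq_eq_norm_sq, hγ1]; simp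
    rw [h1, h2, ← mul_assoc, this, one_mul]
  rw [← hy]
  exact hall _

theorem HasPeaks.exists_replacement (hT : HasPeaks T γ) (hγ : Measurable γ)
    (hγ1 : ∀ x, ‖γ x‖ = 1) {x y : Lp ℂ 1 μ} (hx : ‖x‖ = 1) (hy : ‖y‖ = 1)
    (φ : Lp ℂ 1 μ →L[ℂ] ℂ) {ε : ℝ} (hε : 0 < ε) :
    ∃ z : Lp ℂ 1 μ, ‖z‖ = 1 ∧ ‖T (y - z)‖ + ‖φ (y - z)‖ ≤ ε ∧ 2 - ε ≤ ‖x + z‖ := by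
  set K : ℝ := 4 + ‖T‖ + ‖φ‖ + ε with hK
  have hK0 : 0 < K := by positivity
  set δ : ℝ := ε / (2 * K) with hδ
  have hδ0 : 0 < δ := by positivity
  have hKδ : K * δ = ε / 2 := by rw [hδ]; field_simp
  have e1 : 0 ≤ ‖T‖ * δ := by positivity
  have e2 : 0 ≤ ‖φ‖ * δ := by positivity
  have e3 : 0 ≤ ε * δ := by positivity
  have hexp : 4 * δ + ‖T‖ * δ + ‖φ‖ * δ + ε * δ = ε / 2 := by rw [← hKδ, hK]; ring
  have hδ1 : δ < 1 := by
    by_contra h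
    push Not at h
    nlinarith
  -- Relative error `ε / 2` for `φ`; the other `ε / 2` pays for `δ` and for normalizing `z`, whose
  -- norm lies within `δ` of 1.
  obtain ⟨z, h1, h2, h3, h4⟩ := hT.isReplaceable hγ hγ1 φ (half_pos hε) y x δ hδ0
  rw [hx, hy] at h4
  rw [hy] at h1 h3
  have h5 : 1 - δ ≤ ‖z‖ := by linarith [norm_add_le x z]
  have hz0 : 0 < ‖z‖ := by linarith
  set w : Lp ℂ 1 μ := ((‖z‖⁻¹ : ℝ) : ℂ) • z with hw
  have hw1 : ‖w‖ = 1 := by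
    rw [hw, norm_smul, Complex.norm_real, norm_inv, norm_norm, inv_mul_cancel₀ hz0.ne']
  have hzw : ‖z - w‖ ≤ δ := by
    have : z - w = ((‖z‖ - 1 : ℝ) : ℂ) • w := by
      rw [hw, smul_smul, ← Complex.ofReal_mul, sub_mul, mul_inv_cancel₀ hz0.ne', one_mul]
      push_cast
      module
    rw [this, norm_smul, hw1, mul_one, Complex.norm_real, Real.norm_eq_abs, abs_le]
    constructor <;> linarith
  have hsplit : y - w = (y - z) + (z - w) := by abel
  refine ⟨w, hw1, ?_, ?_⟩
  · have h6 : ‖T (z - w)‖ ≤ ‖T‖ * δ := (T.le_opNorm _).trans (by gcongr)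
    have h7 : ‖φ (z - w)‖ ≤ ‖φ‖ * δ := (φ.le_opNorm _).trans (by gcongr)
    rw [hsplit, map_add, map_add]
    linarith [norm_add_le (T (y - z)) (T (z - w)), norm_add_le (φ (y - z)) (φ (z - w))]
  · have h6 : x + z = (x + w) + (z - w) := by abel
    rw [h6] at h4
    linarith [norm_add_le (x + w) (z - w)]

end Peaks

/-! ### Peaks on the first factor by averaging over the second -/

section Averaging

theorem Finset.exists_pos_and_le_mul {ι : Type*} {s : Finset ι} {m S : ι → ℝ} {δ : ℝ}
    (hm : ∀ i ∈ s, 0 ≤ m i) (hS : ∀ i ∈ s, 0 ≤ S i) (hm1 : ∑ i ∈ s, m i = 1)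
    (hδ : ∑ i ∈ s, S i ≤ δ) : ∃ i ∈ s, 0 < m i ∧ S i ≤ δ * m i := by
  by_contra! hcon
  have hle : ∀ i ∈ s, δ * m i ≤ S i := fun i hi => by
    rcases (hm i hi).eq_or_lt with h | h
    · rw [← h, mul_zero]; exact hS i hi
    · exact (hcon i hi h).le
  obtain ⟨i, hi, hpos⟩ : ∃ i ∈ s, 0 < m i := by
    by_contra! h
    linarith [Finset.sum_nonpos h]
  have h := Finset.sum_lt_sum hle ⟨i, hi, hcon i hi hpos⟩
  rw [← Finset.mul_sum, hm1, mul_one] at h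
  linarith

theorem norm_ofReal_inv_smul {V : Type*} [NormedAddCommGroup V] [NormedSpace ℂ V] {r : ℝ}
    (hr : 0 ≤ r) (v : V) : ‖(r : ℂ)⁻¹ • v‖ = ‖v‖ / r := by
  rw [norm_smul, norm_inv, Complex.norm_real, Real.norm_of_nonneg hr, div_eq_inv_mul]

open Filter

/-- Integration over `A` against a function bounded by 1 captures at most the mass on `A`, so a
pairing close to ‖w‖ leaves little mass outside. -/
theorem setIntegral_compl_norm_le {X : Type*} [MeasurableSpace X] {μ : Measure X} {g : X → ℂ}
    (hg1 : ∀ x, ‖g x‖ ≤ 1) {A : Set X} (hA : MeasurableSet A) (w : Lp ℂ 1 μ) :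
    ∫ t in Aᶜ, ‖w t‖ ∂μ ≤ ‖w‖ - (∫ t, A.indicator g t * w t ∂μ).re := by
  have h1 : ∫ t, A.indicator g t * w t ∂μ = ∫ t in A, g t * w t ∂μ := by
    rw [← integral_indicator hA]
    simp only [Set.indicator_mul_left]
  have h2 : (∫ t in A, g t * w t ∂μ).re ≤ ∫ t in A, ‖w t‖ ∂μ := by
    refine (Complex.re_le_norm _).trans ?_
    refine norm_integral_le_of_norm_le (L1.integrable_coeFn w).norm.integrableOn
      (Eventually.of_forall fun t => ?_)
    rw [norm_mul]
    exact mul_le_of_le_one_left (norm_nonneg _) (hg1 t)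
  have h3 := integral_add_compl hA (L1.integrable_coeFn w).norm
  rw [h1, L1.norm_eq_integral_norm]
  linarith

theorem norm_integral_sub_indicator_le {X : Type*} [MeasurableSpace X] {μ : Measure X} {g : X → ℂ}
    (hg : Measurable g) (hg1 : ∀ x, ‖g x‖ ≤ 1) {A : Set X} (hA : MeasurableSet A)
    (w : Lp ℂ 1 μ) : ‖∫ t, g t * w t ∂μ - ∫ t, A.indicator g t * w t ∂μ‖ ≤
      ∫ t in Aᶜ, ‖w t‖ ∂μ := by
  have h1 : ∫ t, A.indicator g t * w t ∂μ = ∫ t in A, g t * w t ∂μ := by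
    rw [← integral_indicator hA]
    simp only [Set.indicator_mul_left]
  have hi : Integrable (fun t => g t * w t) μ :=
    (L1.integrable_coeFn w).bdd_mul hg.aestronglyMeasurable (Eventually.of_forall hg1)
  rw [h1, ← integral_add_compl hA hi, add_sub_cancel_left]
  refine norm_integral_le_of_norm_le (L1.integrable_coeFn w).norm.integrableOn
    (Eventually.of_forall fun t => ?_)
  rw [norm_mul]
  exact mul_le_of_le_one_left (norm_nonneg _) (hg1 t)

variable {X Y : Type*} [TopologicalSpace X] [CompactSpace X] [TopologicalSpace Y] [CompactSpace Y]
  [MeasurableSpace X] [BorelSpace X] [MeasurableSpace Y] [BorelSpace Y]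
  [MeasurableSpace (X × Y)] [BorelSpace (X × Y)]
  {μ : Measure X} [IsProbabilityMeasure μ] {ν : Measure Y} [IsProbabilityMeasure ν]
  {ρ : Measure (X × Y)} [IsProbabilityMeasure ρ]
  [T2Space X] [T2Space Y] [ρ.WeaklyRegular] [μ.WeaklyRegular]

/-- Fibrewise averages over a fine partition of the second factor turn good replacements in the
product into good replacements in the first factor. -/
theorem hasPeaks_of_fiberIntegral_mem (h : IsProductIntegral μ ν ρ)
    (hfst : MeasurePreserving Prod.fst ρ μ) {γ : X → ℂ} (hγ : Measurable γ)
    (hγ1 : ∀ x, ‖γ x‖ = 1) (L : Submodule ℂ (Lp ℂ 1 ρ)) [IsClosed (L : Set (Lp ℂ 1 ρ))]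
    (N : Submodule ℂ (Lp ℂ 1 μ)) [IsClosed (N : Set (Lp ℂ 1 μ))]
    (hLN : ∀ k, ∀ F ∈ L, fiberIntegral μ ν ρ k F ∈ N)
    (hN : ∀ f ∈ N, ∫ x, conj (γ x) * f x ∂μ = 0)
    (hL : ∀ x y : Lp ℂ 1 ρ, ‖x‖ = 1 → ‖y‖ = 1 → ∀ φ : Lp ℂ 1 ρ →L[ℂ] ℂ, ∀ ε : ℝ, 0 < ε →
      ∃ z, ‖z‖ = 1 ∧ ‖L.mkQL (y - z)‖ + ‖φ (y - z)‖ ≤ ε ∧ 2 - ε ≤ ‖x + z‖) :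
    HasPeaks N.mkQL γ := by
  intro A hA hA0 y hy x hx δ hδ
  have hgm : Measurable fun t => conj (γ t) := Complex.continuous_conj.measurable.comp hγ
  have hg1 : ∀ t, ‖conj (γ t)‖ ≤ 1 := fun t => by rw [RCLike.norm_conj, hγ1]
  have hAg1 : ∀ t, ‖A.indicator (fun t => conj (γ t)) t‖ ≤ 1 := fun t =>
    (norm_indicator_le_norm_self _ _).trans (hg1 t)
  let P : Lp ℂ 1 μ →L[ℂ] ℂ := l1Pairing _ hgm 1 hg1
  let PA : Lp ℂ 1 μ →L[ℂ] ℂ := l1Pairing _ (hgm.indicator hA) 1 hAg1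
  have hP : ∀ f, P f = ∫ t, conj (γ t) * f t ∂μ := fun _ => rfl
  have hPn : ∀ f, ‖P f‖ ≤ ‖f‖ := fun f => by
    rw [hP, L1.norm_eq_integral_norm]
    refine norm_integral_le_of_norm_le (L1.integrable_coeFn f).norm
      (Eventually.of_forall fun t => ?_)
    rw [norm_mul, RCLike.norm_conj, hγ1, one_mul]
  let J := Lp.compMeasurePreservingₗᵢ (E := ℂ) (p := 1) ℂ Prod.fst hfst
  let E : C(Y, ℂ) → Lp ℂ 1 ρ →L[ℂ] Lp ℂ 1 μ := fiberIntegral μ ν ρ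
  have hEJ : ∀ k f, E k (J f) = (∫ t, k t ∂ν) • f := fun k f =>
    fiberIntegral_compMeasurePreserving h hfst k f
  have hy1 : ‖y‖ = 1 := norm_eq_one_of_ae_eq hγ1 hA hA0 hy
  have hPy : P y = 1 := integral_conj_mul_eq_one hγ1 hA hA0 hy
  have hPAy : PA y = 1 := by
    rw [← hPy, hP]
    refine integral_congr_ae ?_
    filter_upwards [hy] with t ht
    rw [ht]
    by_cases htA : t ∈ A <;> simp [htA]
  -- The chosen functional equals 1 on `J y`. Its being close to 1 on `Z`, of norm one, forces
  -- concentration over `A` with phase γ.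
  obtain ⟨Z, hZ1, hZ2, hZ3⟩ := hL (J x) (J y) (by rw [J.norm_map, hx]) (by rw [J.norm_map, hy1])
    (PA.comp (E 1)) (δ / 8) (by positivity)
  have hφ : ‖(PA.comp (E 1)) (J y - Z)‖ ≤ δ / 8 := by
    linarith [norm_nonneg (L.mkQL (J y - Z))]
  have hq : ‖L.mkQL (J y - Z)‖ < 2 * (δ / 8) := by
    linarith [norm_nonneg ((PA.comp (E 1)) (J y - Z))]
  -- A representative of norm below `δ / 4`: `J y - Z` equals `m` up to an element of `L`.
  obtain ⟨m, hm, hmn⟩ := Submodule.Quotient.norm_mk_lt (S := L)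
    (L.mkQL (J y - Z)) (sub_pos.2 hq)
  have hmem : J y - Z - m ∈ L := by
    rw [← Submodule.Quotient.eq]
    exact hm.symm
  rw [add_sub_cancel] at hmn
  obtain ⟨t, k, hk0, hk1, hksum⟩ := exists_partition_norm_fiberIntegral h (J x + Z)
    (by positivity : 0 < δ / 8)
  let w : t → Lp ℂ 1 μ := fun i => E (k i).complexify Z
  let M : t → ℝ := fun i => ∫ s, k i s ∂ν
  have hki : ∀ i, Integrable (k i) ν := fun i =>
    (k i).continuous.integrable_of_hasCompactSupport (HasCompactSupport.of_compactSpace _)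
  have hM0 : ∀ i, 0 ≤ M i := fun i => integral_nonneg (hk0 i)
  have hM1 : ∑ i, M i = 1 := by
    simp only [M]
    rw [← integral_finsetSum _ fun i _ => hki i]
    simp only [hk1]
    simp
  have hEJ' : ∀ i f, E (k i).complexify (J f) = (M i : ℂ) • f := fun i f => by
    rw [hEJ]
    congr 1
    exact integral_complex_ofReal
  have hsum1 : ∀ F, ∑ i, ‖E (k i).complexify F‖ ≤ ‖F‖ := fun F => by
    refine (sum_norm_fiberIntegral_le h Finset.univ (fun i => (k i).complexify) (C := 1)
      (fun s => ?_) F).trans_eq (one_mul _)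
    rw [← hk1 s]
    refine Finset.sum_le_sum fun i _ => ?_
    change ‖(k i s : ℂ)‖ ≤ _
    rw [Complex.norm_real, Real.norm_of_nonneg (hk0 i s)]
  have hkone : ∑ i, (k i).complexify = 1 := by
    ext s
    rw [ContinuousMap.sum_apply]
    change ∑ i, (k i s : ℂ) = 1
    rw [← Complex.ofReal_sum, hk1, Complex.ofReal_one]
  have hEsum : ∑ i, w i = E 1 Z := by
    change _ = fiberIntegralWeight h Z 1
    rw [← hkone, map_sum]
    rfl
  have hdiff : ∀ i, (M i : ℂ) • y - w i = E (k i).complexify (J y - Z - m) +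
      E (k i).complexify m := fun i => by
    rw [← map_add, sub_add_cancel, map_sub, hEJ']
  -- Three nonnegative defects of the piece `w i`: distance to `y` modulo `N`, failure to be
  -- concentrated on `A` with phase γ, and failure of orthogonality to `x`. Their sums over `i` are
  -- at most `δ / 4`, `δ / 8` and `δ / 4`.
  let e : t → ℝ := fun i => ‖E (k i).complexify m‖
  let c : t → ℝ := fun i => ‖w i‖ - (PA (w i)).re
  let d : t → ℝ := fun i => M i + ‖w i‖ - ‖(M i : ℂ) • x + w i‖
  have hcA : ∀ i, ∫ s in Aᶜ, ‖w i s‖ ∂μ ≤ c i := fun i => setIntegral_compl_norm_le hg1 hA (w i)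
  have hc0 : ∀ i, 0 ≤ c i := fun i => (integral_nonneg fun _ => norm_nonneg _).trans (hcA i)
  have he0 : ∀ i, 0 ≤ e i := fun i => norm_nonneg _
  have hMx : ∀ i, ‖(M i : ℂ) • x‖ = M i := fun i => by
    rw [norm_smul, hx, mul_one, Complex.norm_real, Real.norm_of_nonneg (hM0 i)]
  have hd0 : ∀ i, 0 ≤ d i := fun i => by
    have := norm_add_le ((M i : ℂ) • x) (w i)
    rw [hMx] at this
    simp only [d]
    linarith
  have hse : ∑ i, e i ≤ δ / 4 := by linarith [hsum1 m]
  have hsw : ∑ i, ‖w i‖ ≤ 1 := (hsum1 Z).trans_eq hZ1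
  have hsc : ∑ i, c i ≤ δ / 8 := by
    have h1 : ∑ i, (PA (w i)).re = (PA (E 1 Z)).re := by
      rw [← hEsum, map_sum, Complex.re_sum]
    have h2 : (PA.comp (E 1)) (J y - Z) = 1 - PA (E 1 Z) := by
      rw [ContinuousLinearMap.comp_apply, map_sub, hEJ, map_sub, map_smul, hPAy]
      simp
    rw [h2] at hφ
    have h3 := (Complex.re_le_norm _).trans hφ
    rw [Complex.sub_re, Complex.one_re] at h3
    simp only [c, Finset.sum_sub_distrib, h1]
    linarith
  have hsd : ∑ i, d i ≤ δ / 4 := by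
    have h1 : ∑ i, ‖fiberIntegral μ ν ρ (k i).complexify (J x + Z)‖ =
        ∑ i, ‖(M i : ℂ) • x + w i‖ := by
      refine Finset.sum_congr rfl fun i _ => ?_
      rw [map_add]
      exact congrArg (fun f => ‖f + w i‖) (hEJ' i x)
    rw [h1] at hksum
    simp only [d, Finset.sum_sub_distrib, Finset.sum_add_distrib, hM1]
    linarith
  -- The masses sum to 1, so some index has total defect at most `δ` times its mass. The weight 2 on
  -- `c` is what the upper norm bound `hwle` requires.
  obtain ⟨i, -, hMi, hSi⟩ := Finset.exists_pos_and_le_mul (s := Finset.univ) (m := M)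
    (S := fun i => e i + 2 * c i + d i) (δ := δ) (fun i _ => hM0 i)
    (fun i _ => by linarith [hc0 i, he0 i, hd0 i]) hM1 (by
      rw [Finset.sum_add_distrib, Finset.sum_add_distrib, ← Finset.mul_sum]
      linarith)
  have hci := hc0 i
  have hei := he0 i
  have hdi := hd0 i
  -- The coefficient at γ vanishes on `N`, so it sees only the small part coming from `m`. This ties
  -- ‖w i‖ to `M i`.
  have hEm : ‖P ((M i : ℂ) • y - w i)‖ ≤ e i := by
    rw [hdiff, map_add, hP, hN _ (hLN _ _ hmem), zero_add]
    exact hPn _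
  have hPw : ‖(M i : ℂ) - P (w i)‖ ≤ e i := by
    rwa [map_sub, map_smul, hPy, smul_eq_mul, mul_one] at hEm
  have hTw : ‖N.mkQL ((M i : ℂ) • y - w i)‖ ≤ e i := by
    have h0 : N.mkQL (E (k i).complexify (J y - Z - m)) = 0 :=
      (Submodule.Quotient.mk_eq_zero N).2 (hLN _ _ hmem)
    rw [hdiff, map_add, h0, zero_add]
    exact Submodule.Quotient.norm_mk_le N _
  have hPPA : ‖P (w i) - PA (w i)‖ ≤ c i :=
    (norm_integral_sub_indicator_le hgm hg1 hA (w i)).trans (hcA i)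
  have hwle : ‖w i‖ ≤ M i + e i + 2 * c i := by
    have h1 := (Complex.abs_re_le_norm _).trans hPw
    have h2 := (Complex.abs_re_le_norm _).trans hPPA
    rw [Complex.sub_re, Complex.ofReal_re] at h1
    rw [Complex.sub_re] at h2
    have h3 : ‖w i‖ = c i + (PA (w i)).re := by simp only [c]; ring
    linarith [neg_abs_le (M i - (P (w i)).re), neg_abs_le ((P (w i)).re - (PA (w i)).re)]
  have hwge : M i - e i ≤ ‖w i‖ := by
    have h1 := norm_le_norm_add_norm_sub (P (w i)) (M i : ℂ)
    rw [Complex.norm_real, Real.norm_of_nonneg (hM0 i), norm_sub_rev] at h1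
    linarith [hPn (w i)]
  have hMc : (M i : ℂ) ≠ 0 := by exact_mod_cast hMi.ne'
  refine ⟨(M i : ℂ)⁻¹ • w i, ?_, ?_, ?_, ?_, ?_⟩
  · rw [norm_ofReal_inv_smul (hM0 i), div_le_iff₀ hMi]
    linarith
  · have h1 : y - (M i : ℂ)⁻¹ • w i = (M i : ℂ)⁻¹ • ((M i : ℂ) • y - w i) := by
      rw [smul_sub, inv_smul_smul₀ hMc]
    rw [h1, map_smul]
    refine (norm_ofReal_inv_smul (hM0 i) (N.mkQL _)).trans_le ?_
    rw [div_le_iff₀ hMi]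
    linarith
  · have h1 : ∫ s in Aᶜ, ‖((M i : ℂ)⁻¹ • w i : Lp ℂ 1 μ) s‖ ∂μ =
        (M i)⁻¹ * ∫ s in Aᶜ, ‖w i s‖ ∂μ := by
      rw [← integral_const_mul]
      refine integral_congr_ae (ae_restrict_of_ae ?_)
      filter_upwards [Lp.coeFn_smul (M i : ℂ)⁻¹ (w i)] with s hs
      rw [hs, Pi.smul_apply, norm_ofReal_inv_smul (hM0 i), div_eq_inv_mul]
    rw [h1, ← div_eq_inv_mul, div_le_iff₀ hMi]
    linarith [hcA i]
  · have h1 : P ((M i : ℂ)⁻¹ • w i) - 1 = -((M i : ℂ)⁻¹ • ((M i : ℂ) - P (w i))) := by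
      rw [map_smul, smul_sub, smul_eq_mul, smul_eq_mul, inv_mul_cancel₀ hMc]
      ring
    rw [← hP, h1, norm_neg, norm_ofReal_inv_smul (hM0 i), div_le_iff₀ hMi]
    linarith
  · have h1 : x + (M i : ℂ)⁻¹ • w i = (M i : ℂ)⁻¹ • ((M i : ℂ) • x + w i) := by
      rw [smul_add, inv_smul_smul₀ hMc]
    have h2 : ‖(M i : ℂ) • x + w i‖ = M i + ‖w i‖ - d i := by simp only [d]; ring
    rw [h1, norm_ofReal_inv_smul (hM0 i), le_div_iff₀ hMi, h2]
    linarith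

end Averaging

/-- With `x` a unit vector spanning the range of `T`, choose `z` almost ℓ¹-orthogonal to `x` with T
z ≈ ‖T‖ x. Then z + T z ≈ z + ‖T‖ x has norm about 1 + ‖T‖. -/
theorem daugavetProperty_of_exists {V : Type*} [NormedAddCommGroup V] [NormedSpace ℂ V]
    (h : ∀ x y : V, ‖x‖ = 1 → ‖y‖ = 1 → ∀ φ : V →L[ℂ] ℂ, ∀ ε : ℝ, 0 < ε →
      ∃ z, ‖z‖ = 1 ∧ ‖φ (y - z)‖ ≤ ε ∧ 2 - ε ≤ ‖x + z‖) : DaugavetProperty ℂ V := by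
  intro T hT
  refine le_antisymm ((norm_add_le _ _).trans
    (add_le_add_left ContinuousLinearMap.norm_id_le _)) ?_
  obtain ⟨⟨v, hv⟩, hv0, hspan⟩ := finrank_eq_one_iff'.1 hT
  have hv0' : ‖v‖ ≠ 0 := fun h0 => hv0 (Subtype.ext (norm_eq_zero.1 h0))
  set x : V := (‖v‖ : ℂ)⁻¹ • v with hx
  have hx1 : ‖x‖ = 1 := by
    rw [hx, norm_ofReal_inv_smul (norm_nonneg _), div_self hv0']
  have hTx : ∀ u, ∃ c : ℂ, T u = c • x := fun u => by
    obtain ⟨c, hc⟩ := hspan ⟨T u, u, rfl⟩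
    refine ⟨c * ‖v‖, ?_⟩
    have h1 : c • v = T u := congrArg Subtype.val hc
    rw [← h1, hx, smul_smul, mul_assoc, mul_inv_cancel₀ (by exact_mod_cast hv0'), mul_one]
  obtain ⟨g, hg1, hgx⟩ := exists_dual_vector ℂ x (by rw [hx1]; exact one_ne_zero)
  have hgx1 : g x = 1 := by rw [hgx, hx1]; rfl
  have hTg : ∀ u, T u = g (T u) • x := fun u => by
    obtain ⟨c, hc⟩ := hTx u
    rw [hc, map_smul, hgx1, smul_eq_mul, mul_one]
  have hTn : ∀ u, ‖T u‖ = ‖g (T u)‖ := fun u => by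
    conv_lhs => rw [hTg, norm_smul, hx1, mul_one]
  refine le_of_forall_sub_le fun η hη => ?_
  -- `2 * ‖T‖ + 1` comes from rescaling `x` in `le_norm_smul_add`, and 2 from the error in T z ≈ ‖T‖
  -- x.
  set K : ℝ := 2 * ‖T‖ + 3 with hK
  have hK0 : 0 < K := by positivity
  set ε : ℝ := η / K with hε
  have hε0 : 0 < ε := by positivity
  have hKε : K * ε = η := by rw [hε]; field_simp
  have hT0 : 0 < ‖T‖ := by
    refine norm_pos_iff.2 fun h0 => hv0 (Subtype.ext ?_)
    obtain ⟨u, hu⟩ := hv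
    exact Eq.trans hu.symm (by rw [h0]; rfl)
  obtain ⟨y, hy1, hyT⟩ := T.exists_nnnorm_eq_one_lt_apply_of_lt_opNNNorm
    (r := (‖T‖ - ε).toNNReal) (by
      rw [← NNReal.coe_lt_coe, Real.coe_toNNReal', coe_nnnorm]
      exact max_lt (by linarith) hT0)
  have hy1' : ‖y‖ = 1 := by rw [← coe_nnnorm, hy1, NNReal.coe_one]
  rw [← NNReal.coe_lt_coe, Real.coe_toNNReal', coe_nnnorm] at hyT
  have hyT' : ‖T‖ - ε < ‖T y‖ := (le_max_left _ _).trans_lt hyT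
  have hyT2 : ‖T y‖ ≤ ‖T‖ := by simpa [hy1'] using T.le_opNorm y
  -- Rotating `y` makes its value under `g ∘ T` the positive number ‖T y‖.
  obtain ⟨c, hc1, hc⟩ := RCLike.exists_norm_eq_mul_self (g (T y))
  obtain ⟨z, hz1, hz2, hz3⟩ := h x (c • y) hx1 (by rw [norm_smul, hc1, hy1', one_mul])
    (g.comp T) ε hε0
  rw [map_sub, map_smul, ContinuousLinearMap.comp_apply, ContinuousLinearMap.comp_apply,
    smul_eq_mul, ← hc, ← hTn] at hz2
  have h1 : ‖((‖T‖ : ℂ) - g (T z))‖ ≤ 2 * ε := by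
    have h2 : (‖T‖ : ℂ) - g (T z) = ((‖T‖ - ‖T y‖ : ℝ) : ℂ) + ((‖T y‖ : ℂ) - g (T z)) := by
      push_cast; ring
    rw [h2]
    refine (norm_add_le _ _).trans ?_
    rw [Complex.norm_real, Real.norm_of_nonneg (by linarith)]
    have hz2' : ‖(‖T y‖ : ℂ) - g (T z)‖ ≤ ε := hz2
    linarith
  have h2 := le_norm_smul_add hT0.le hε0.le hx1 (by linarith) hz3
  have h3 : (‖T‖ : ℂ) • x + z = (z + T z) + ((‖T‖ : ℂ) - g (T z)) • x := by
    conv_rhs => rw [hTg z]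
    rw [map_smul, hgx1, smul_eq_mul, mul_one]
    module
  have h4 := norm_add_le (z + T z) (((‖T‖ : ℂ) - g (T z)) • x)
  rw [← h3, norm_smul, hx1, mul_one] at h4
  have h5 : ‖z + T z‖ ≤ ‖ContinuousLinearMap.id ℂ V + T‖ := by
    simpa [hz1] using (ContinuousLinearMap.id ℂ V + T).le_opNorm z
  have h6 : 2 * ‖T‖ * ε + 3 * ε = η := by rw [← hKε, hK]; ring
  linarith

/-! ### Haar measure on a product and on an infinite group -/

section Haar

open Filter

variable {G₁ G₂ : Type*} [CommGroup G₁] [TopologicalSpace G₁] [IsTopologicalGroup G₁]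
  [CompactSpace G₁] [MeasurableSpace G₁] [BorelSpace G₁]
  [CommGroup G₂] [TopologicalSpace G₂] [IsTopologicalGroup G₂] [CompactSpace G₂]
  [MeasurableSpace G₂] [BorelSpace G₂] [MeasurableSpace (G₁ × G₂)] [BorelSpace (G₁ × G₂)]
  (μ : Measure G₁) [IsProbabilityMeasure μ] [μ.IsHaarMeasure]
  (ν : Measure G₂) [IsProbabilityMeasure ν] [ν.IsHaarMeasure]
  (ρ : Measure (G₁ × G₂)) [IsProbabilityMeasure ρ] [ρ.IsHaarMeasure]

/-- The usual uniqueness computation: integrate F(a p₁, b p₂) over all variables in both orders and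
use invariance of each measure. Only continuous functions are interchanged, so the Borel σ-algebra
of the product may exceed the product σ-algebra. -/
theorem isProductIntegral_of_isHaarMeasure : IsProductIntegral μ ν ρ := by
  intro F
  have hcont : Continuous fun q : G₁ × (G₁ × G₂) => ∫ b, F (q.1 * q.2.1, b * q.2.2) ∂ν := by
    have h := ContinuousMap.continuous_integral_mul ν
      (⟨fun r => F (r.1.1 * r.1.2.1, r.2 * r.1.2.2), by fun_prop⟩ :
        C((G₁ × (G₁ × G₂)) × G₂, ℂ)) 1
    simpa only [ContinuousMap.coe_mk, ContinuousMap.one_apply, mul_one] using h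
  have hinv : ∀ a b, ∫ p, F (a * p.1, b * p.2) ∂ρ = ∫ p, F p ∂ρ := fun a b =>
    integral_mul_left_eq_self (fun p => F p) ((a, b) : G₁ × G₂)
  calc ∫ p, F p ∂ρ = ∫ a, ∫ b, ∫ p, F (a * p.1, b * p.2) ∂ρ ∂ν ∂μ := by
        simp [hinv]
    _ = ∫ a, ∫ p, ∫ b, F (a * p.1, b * p.2) ∂ν ∂ρ ∂μ := by
        refine integral_congr_ae (Eventually.of_forall fun a => ?_)
        exact integral_integral_swap_of_hasCompactSupport
          (f := fun b (p : G₁ × G₂) => F (a * p.1, b * p.2))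
          (by unfold Function.uncurry; fun_prop) (HasCompactSupport.of_compactSpace _)
    _ = ∫ p, ∫ a, ∫ b, F (a * p.1, b * p.2) ∂ν ∂μ ∂ρ :=
        integral_integral_swap_of_hasCompactSupport
          (f := fun a (p : G₁ × G₂) => ∫ b, F (a * p.1, b * p.2) ∂ν) hcont
          (HasCompactSupport.of_compactSpace _)
    _ = ∫ p : G₁ × G₂, ∫ a, ∫ b, F (a, b) ∂ν ∂μ ∂ρ := by
        refine integral_congr_ae (Eventually.of_forall fun p => ?_)
        dsimp only
        have h1 : ∀ a, ∫ b, F (a * p.1, b * p.2) ∂ν = ∫ b, F (a * p.1, b) ∂ν := fun a =>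
          integral_mul_right_eq_self (fun b => F (a * p.1, b)) p.2
        simp only [h1]
        exact integral_mul_right_eq_self (fun a => ∫ b, F (a, b) ∂ν) p.1
    _ = ∫ x, ∫ y, F (x, y) ∂ν ∂μ := by simp

theorem measurePreserving_fst_of_isHaarMeasure : MeasurePreserving Prod.fst ρ μ := by
  have hm : Measurable (Prod.fst : G₁ × G₂ → G₁) := continuous_fst.measurable
  have : (ρ.map Prod.fst).IsHaarMeasure :=
    Measure.isHaarMeasure_map ρ (MonoidHom.fst G₁ G₂) continuous_fst Prod.fst_surjective
      (by simp)
  have : IsProbabilityMeasure (ρ.map Prod.fst) := Measure.isProbabilityMeasure_map hm.aemeasurable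
  exact ⟨hm, Measure.isHaarMeasure_eq_of_isProbabilityMeasure _ _⟩

/-- An infinite compact group is not discrete, so 1 is not isolated. -/
theorem nullSingletonClass_of_infinite [T1Space G₁] [Infinite G₁] :
    NullSingletonClass μ := by
  have : (nhdsWithin (1 : G₁) {1}ᶜ).NeBot := by
    rw [← not_not (a := NeBot _), not_neBot, ← isOpen_singleton_iff_punctured_nhds]
    intro h
    have := discreteTopology_of_isOpen_singleton_one h
    exact not_finite_iff_infinite.2 ‹_› (finite_of_compact_of_discrete (X := G₁))
  infer_instance

end Haar

/-! ### Peaks for the zero operator without atoms -/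

section NullSingletons

open Filter

variable {X : Type*} [TopologicalSpace X] [CompactSpace X] [MeasurableSpace X] [BorelSpace X]
  {μ : Measure X} [IsProbabilityMeasure μ] [NullSingletonClass μ] [μ.OuterRegular]
  {E : Type*} [NormedAddCommGroup E] [NormedSpace ℂ E]

/-- Finitely many open sets of small measure cover `X`, and one meets `A` in a non-null set `B`. By
absolute continuity `x` has little mass on `B`, so the normalized indicator of `B` is almost
disjoint from `x`. -/
theorem hasPeaks_one_of_nullSingletonClass {T : Lp ℂ 1 μ →L[ℂ] E} (hT : ∀ f, T f = 0) :
    HasPeaks T 1 := by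
  intro A hA hA0 y hy x hx δ hδ
  have hxi := L1.integrable_coeFn x
  obtain ⟨r, hr0, hr⟩ := exists_pos_setLIntegral_lt_of_measure_lt (μ := μ)
    (f := fun t => ‖x t‖ₑ) hxi.2.ne (ε := ENNReal.ofReal (δ / 2)) (by simpa using hδ)
  have hU : ∀ p : X, ∃ U, p ∈ U ∧ IsOpen U ∧ μ U < r := fun p => by
    obtain ⟨U, hpU, hU, hUr⟩ := Set.exists_isOpen_lt_of_lt {p} r
      (by rw [measure_singleton]; exact hr0 : μ {p} < r)
    exact ⟨U, hpU rfl, hU, hUr⟩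
  choose U hpU hUo hUr using hU
  obtain ⟨t, ht⟩ := isCompact_univ.elim_finite_subcover U hUo
    fun p _ => Set.mem_iUnion.2 ⟨p, hpU p⟩
  obtain ⟨p, -, hp⟩ : ∃ p ∈ t, μ (A ∩ U p) ≠ 0 := by
    by_contra! hcon
    refine hA0 (measure_mono_null (t := ⋃ p ∈ t, A ∩ U p) (fun s hs => ?_)
      ((measure_biUnion_null_iff t.countable_toSet).2 hcon))
    obtain ⟨p, hp, hs'⟩ := Set.mem_iUnion₂.1 (ht (Set.mem_univ s))
    exact Set.mem_iUnion₂.2 ⟨p, hp, hs, hs'⟩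
  set B : Set X := A ∩ U p with hB
  have hBm : MeasurableSet B := hA.inter (hUo p).measurableSet
  have hBx : ∫ s in B, ‖x s‖ ∂μ ≤ δ / 2 := by
    rw [integral_norm_eq_lintegral_enorm hxi.aestronglyMeasurable.restrict]
    exact ENNReal.toReal_le_of_le_ofReal (by positivity)
      (hr B ((measure_mono Set.inter_subset_right).trans_lt (hUr p))).le
  let z : Lp ℂ 1 μ := indicatorConstLp 1 hBm (measure_ne_top μ B) ((μ.real B)⁻¹ : ℂ)
  have hz : z =ᵐ[μ] fun s => ((μ.real B)⁻¹ : ℂ) * B.indicator 1 s := by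
    filter_upwards [indicatorConstLp_coeFn (p := 1) (hs := hBm) (hμs := measure_ne_top μ B)
      (c := ((μ.real B)⁻¹ : ℂ))] with s hs
    rw [hs]
    by_cases hsB : s ∈ B <;> simp [hsB]
  have h1 : ∀ s, ‖(1 : X → ℂ) s‖ = 1 := fun s => by simp
  have hz1 : ‖z‖ = 1 := norm_eq_one_of_ae_eq h1 hBm hp hz
  refine ⟨z, by linarith, by rw [hT, norm_zero]; exact hδ.le, ?_, ?_, ?_⟩
  · rw [integral_eq_zero_of_ae]
    · exact hδ.le
    · filter_upwards [ae_restrict_of_ae hz, ae_restrict_mem hA.compl] with s hs hsA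
      rw [hs, Set.indicator_of_notMem fun h => hsA h.1, mul_zero, norm_zero, Pi.zero_apply]
  · rw [integral_conj_mul_eq_one h1 hBm hp hz, sub_self, norm_zero]
    exact hδ.le
  · have hi := L1.integrable_coeFn z
    have hind : Integrable (B.indicator fun s => 2 * ‖x s‖) μ :=
      (hxi.norm.const_mul 2).indicator hBm
    have hle : ∫ s, (‖x s‖ + ‖z s‖ - B.indicator (fun s => 2 * ‖x s‖) s) ∂μ ≤
        ∫ s, ‖(x + z : Lp ℂ 1 μ) s‖ ∂μ := by
      refine integral_mono_ae ((hxi.norm.add hi.norm).sub hind)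
        (L1.integrable_coeFn (x + z)).norm ?_
      filter_upwards [hz, Lp.coeFn_add x z] with s hs hxz
      rw [hxz, Pi.add_apply]
      by_cases hsB : s ∈ B
      · rw [Set.indicator_of_mem hsB]
        have := norm_sub_le (x s + z s) (x s)
        rw [add_sub_cancel_left] at this
        linarith
      · rw [Set.indicator_of_notMem hsB, hs, Set.indicator_of_notMem hsB]
        simp
    have hsplit : ∫ s, (‖x s‖ + ‖z s‖ - B.indicator (fun s => 2 * ‖x s‖) s) ∂μ =
        ∫ s, ‖x s‖ ∂μ + ∫ s, ‖z s‖ ∂μ - 2 * ∫ s in B, ‖x s‖ ∂μ := by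
      have h2 : Integrable (fun s => ‖x s‖ + ‖z s‖) μ := hxi.norm.add hi.norm
      rw [integral_sub h2 hind, integral_add hxi.norm hi.norm, integral_indicator hBm,
        integral_const_mul]
    rw [hsplit, ← L1.norm_eq_integral_norm, ← L1.norm_eq_integral_norm,
      ← L1.norm_eq_integral_norm, hx, hz1] at hle
    linarith

end NullSingletons

/-! ### Atoms exclude peaks -/

section Atoms

open Filter

variable {X : Type*} [MeasurableSpace X] {μ : Measure X} [IsProbabilityMeasure μ]
  {E : Type*} [NormedAddCommGroup E] [NormedSpace ℂ E]

/-- A peak at an atom is close in norm to `y`, because it is determined there by its pairing with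
`conj γ`. Taking `x = -y` would require ‖y - z‖ to be close to 2. -/
theorem not_hasPeaks_of_measure_singleton_ne_zero [MeasurableSingletonClass X] {γ : X → ℂ}
    (hγ : Measurable γ) (hγ1 : ∀ x, ‖γ x‖ = 1) {p : X} (hp : μ {p} ≠ 0)
    (T : Lp ℂ 1 μ →L[ℂ] E) : ¬ HasPeaks T γ := by
  intro hT
  have hpm : MeasurableSet {p} := measurableSet_singleton p
  have hi : Integrable (fun x => ((μ.real {p})⁻¹ : ℂ) * ({p} : Set X).indicator γ x) μ :=
    ((Integrable.of_bound hγ.aestronglyMeasurable 1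
      (Eventually.of_forall fun x => (hγ1 x).le)).indicator hpm).const_mul _
  set y : Lp ℂ 1 μ := hi.toL1 _ with hydef
  have hy := hi.coeFn_toL1
  rw [← hydef] at hy
  have hy1 : ‖y‖ = 1 := norm_eq_one_of_ae_eq hγ1 hpm hp hy
  obtain ⟨z, -, -, h3, h4, h5⟩ := hT {p} hpm hp y hy (-y) (by rw [norm_neg, hy1])
    (1 / 4) (by norm_num)
  have hgm : Measurable fun t => conj (γ t) := Complex.continuous_conj.measurable.comp hγ
  have hg1 : ∀ t, ‖conj (γ t)‖ ≤ 1 := fun t => by rw [RCLike.norm_conj, hγ1]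
  have hcompl : ∫ t in {p}ᶜ, ‖(y - z : Lp ℂ 1 μ) t‖ ∂μ ≤ 1 / 4 := by
    refine le_trans (le_of_eq ?_) h3
    refine integral_congr_ae ?_
    filter_upwards [ae_restrict_of_ae hy, ae_restrict_of_ae (Lp.coeFn_sub y z),
      ae_restrict_mem hpm.compl] with t ht hs hmem
    rw [hs, Pi.sub_apply, ht, Set.indicator_of_notMem hmem, mul_zero, zero_sub, norm_neg]
  have hall : ‖∫ t, conj (γ t) * (y - z : Lp ℂ 1 μ) t ∂μ‖ ≤ 1 / 4 := by
    have h6 := map_sub (l1Pairing (μ := μ) _ hgm 1 hg1) y z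
    simp only [l1Pairing_apply] at h6
    rw [h6, integral_conj_mul_eq_one hγ1 hpm hp hy, norm_sub_rev]
    exact h4
  have hsub := norm_integral_sub_indicator_le hgm hg1 hpm (y - z)
  have hatom : ‖∫ t, ({p} : Set X).indicator (fun t => conj (γ t)) t * (y - z : Lp ℂ 1 μ) t ∂μ‖ =
      ∫ t in {p}, ‖(y - z : Lp ℂ 1 μ) t‖ ∂μ := by
    simp only [← Set.indicator_mul_left]
    rw [integral_indicator hpm, integral_singleton, integral_singleton, norm_smul, norm_mul,
      RCLike.norm_conj, hγ1, one_mul, Real.norm_of_nonneg measureReal_nonneg, smul_eq_mul]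
  have hsplit := integral_add_compl hpm (L1.integrable_coeFn (y - z)).norm
  rw [← L1.norm_eq_integral_norm] at hsplit
  have hneg : ‖-y + z‖ = ‖y - z‖ := by rw [← norm_neg]; congr 1; abel
  rw [hneg] at h5
  have h7 := norm_le_norm_add_norm_sub (∫ t, conj (γ t) * (y - z : Lp ℂ 1 μ) t ∂μ)
    (∫ t, ({p} : Set X).indicator (fun t => conj (γ t)) t * (y - z : Lp ℂ 1 μ) t ∂μ)
  linarith

end Atoms

/-! ### Fourier coefficients of fibre integrals -/

section Coefficients

variable {G₁ G₂ : Type*} [CommGroup G₁] [TopologicalSpace G₁] [IsTopologicalGroup G₁]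
  [CompactSpace G₁] [T2Space G₁] [MeasurableSpace G₁] [BorelSpace G₁]
  [CommGroup G₂] [TopologicalSpace G₂] [IsTopologicalGroup G₂] [CompactSpace G₂] [T2Space G₂]
  [MeasurableSpace G₂] [BorelSpace G₂] [MeasurableSpace (G₁ × G₂)] [BorelSpace (G₁ × G₂)]
  {μ : Measure G₁} [IsProbabilityMeasure μ] {ν : Measure G₂} [IsProbabilityMeasure ν]
  {ρ : Measure (G₁ × G₂)} [IsProbabilityMeasure ρ] [ρ.WeaklyRegular]

/-- The left side is a continuous functional of `k`. On a character χ it is the coefficient of `F`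
at the tensor product of γ with the inverse of χ, which vanishes; density of trigonometric
polynomials does the rest. -/
theorem integral_conj_mul_fiberIntegral_eq_zero (h : IsProductIntegral μ ν ρ)
    (γ : PontryaginDual G₁) (F : Lp ℂ 1 ρ)
    (hF : ∀ χ : PontryaginDual G₂, ∫ p, conj (γ p.1 * χ p.2 : ℂ) * F p ∂ρ = 0) (k : C(G₂, ℂ)) :
    ∫ x, conj (γ x : ℂ) * fiberIntegral μ ν ρ k F x ∂μ = 0 := by
  let a : C(G₁, ℂ) := γ⁻¹.toContinuousMap
  have ha : ∀ x, a x = conj (γ x : ℂ) := fun x => Circle.coe_inv_eq_conj (γ x)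
  let Φ : C(G₂, ℂ) →L[ℂ] ℂ :=
    (l1Pairing a a.continuous.measurable ‖a‖ a.norm_coe_le_norm).comp (fiberIntegralWeight h F)
  have hΦ : ∀ k, Φ k = ∫ x, conj (γ x : ℂ) * fiberIntegral μ ν ρ k F x ∂μ := fun k => by
    simp only [← ha]
    rfl
  have hle : (Submodule.span ℂ (Set.range PontryaginDual.toContinuousMap)).topologicalClosure ≤
      Φ.toLinearMap.ker := by
    refine Submodule.topologicalClosure_minimal _ (Submodule.span_le.2 ?_) Φ.isClosed_ker
    rintro _ ⟨χ, rfl⟩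
    change Φ _ = 0
    have h1 : Φ χ.toContinuousMap =
        ∫ p, a p.1 * χ.toContinuousMap p.2 * F p ∂ρ := l1Pairing_fiberIntegral h a _ F
    rw [h1, ← hF χ⁻¹]
    refine integral_congr_ae (Filter.Eventually.of_forall fun p => ?_)
    have h2 : ((χ⁻¹ p.2 : Circle) : ℂ) = conj (χ p.2 : ℂ) := Circle.coe_inv_eq_conj (χ p.2)
    dsimp only
    rw [ha, _root_.map_mul, h2, Complex.conj_conj, PontryaginDual.toContinuousMap_apply]
  rw [PontryaginDual.span_toContinuousMap_closure_eq_top] at hle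
  rw [← hΦ]
  exact hle (Submodule.mem_top (x := k))

end Coefficients

/-! ### The theorem on projections of spectra -/

theorem mem_L1Spec_iff {G : Type*} [CommGroup G] [TopologicalSpace G] [IsTopologicalGroup G]
    [CompactSpace G] {Λ : Set (PontryaginDual G)} {f : L1 G} :
    f ∈ L1Spec Λ ↔ ∀ γ ∉ Λ, fourierCoeffL1 f γ = 0 :=
  ⟨fun hf _ hγ => not_not.1 fun h => hγ (hf h), fun hf γ hγ => not_not.1 fun h => hγ (hf γ h)⟩

theorem mainTheorem12
    {G₁ G₂ : Type*}
    [CommGroup G₁] [TopologicalSpace G₁] [IsTopologicalGroup G₁] [CompactSpace G₁] [T2Space G₁]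
    [CommGroup G₂] [TopologicalSpace G₂] [IsTopologicalGroup G₂] [CompactSpace G₂] [T2Space G₂]
    (Λ : Set (PontryaginDual G₁ × PontryaginDual G₂))
    (hΛ : IsRich (L1Spec (G := G₁ × G₂) (dualProdEquiv G₁ G₂ '' Λ))) :
    (Infinite G₁ → IsRich (L1Spec (G := G₁) (Prod.fst '' Λ))) ∧
      (Finite G₁ → Prod.fst '' Λ = Set.univ) := by
  let : MeasurableSpace G₁ := borel G₁
  have : BorelSpace G₁ := ⟨rfl⟩
  let : MeasurableSpace G₂ := borel G₂
  have : BorelSpace G₂ := ⟨rfl⟩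
  let : MeasurableSpace (G₁ × G₂) := borel (G₁ × G₂)
  have : BorelSpace (G₁ × G₂) := ⟨rfl⟩
  have : (haarProb G₁).IsHaarMeasure := Measure.isHaarMeasure_haarMeasure _
  have : (haarProb G₂).IsHaarMeasure := Measure.isHaarMeasure_haarMeasure _
  have : (haarProb (G₁ × G₂)).IsHaarMeasure := Measure.isHaarMeasure_haarMeasure _
  have : (haarProb G₁).Regular := Measure.regular_haarMeasure
  have : (haarProb (G₁ × G₂)).Regular := Measure.regular_haarMeasure
  have hprod : IsProductIntegral (haarProb G₁) (haarProb G₂) (haarProb (G₁ × G₂)) :=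
    isProductIntegral_of_isHaarMeasure _ _ _
  have hγm : ∀ γ : PontryaginDual G₁, Measurable fun x => (γ x : ℂ) := fun γ =>
    γ.toContinuousMap.continuous.measurable
  have hγ1 : ∀ (γ : PontryaginDual G₁) x, ‖(γ x : ℂ)‖ = 1 := fun γ x => Circle.norm_coe _
  have hpeaks : ∀ γ : PontryaginDual G₁, γ ∉ Prod.fst '' Λ →
      HasPeaks (L1Spec (G := G₁) (Prod.fst '' Λ)).mkQL fun x => (γ x : ℂ) := fun γ hγ => by
    refine hasPeaks_of_fiberIntegral_mem hprod (measurePreserving_fst_of_isHaarMeasure _ _)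
      (hγm γ) (hγ1 γ) (L1Spec (G := G₁ × G₂) (dualProdEquiv G₁ G₂ '' Λ)) _
      (fun k F hF => mem_L1Spec_iff.2 fun γ' hγ' => ?_) (fun f hf => mem_L1Spec_iff.1 hf γ hγ)
      hΛ.2
    refine integral_conj_mul_fiberIntegral_eq_zero hprod γ' F (fun χ => ?_) k
    refine mem_L1Spec_iff.1 hF (dualProdEquiv G₁ G₂ (γ', χ)) fun hmem => hγ' ?_
    obtain ⟨q, hq, hqe⟩ := hmem
    exact ⟨q, hq, congrArg Prod.fst ((dualProdEquiv G₁ G₂).injective hqe)⟩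
  refine ⟨fun hinf => ?_, fun hfin => ?_⟩
  · obtain ⟨γ, hγ, hγ', hT⟩ : ∃ γ : G₁ → ℂ, Measurable γ ∧ (∀ x, ‖γ x‖ = 1) ∧
        HasPeaks (L1Spec (G := G₁) (Prod.fst '' Λ)).mkQL γ := by
      -- If nothing lies outside p[Λ], the quotient map is zero and the trivial phase serves;
      -- otherwise any missing character does.
      by_cases h : Prod.fst '' Λ = Set.univ
      · have := nullSingletonClass_of_infinite (haarProb G₁)
        refine ⟨1, measurable_one, fun x => by simp,
          hasPeaks_one_of_nullSingletonClass fun f => ?_⟩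
        refine (Submodule.Quotient.mk_eq_zero _).2 (mem_L1Spec_iff.2 fun γ hγ => absurd ?_ hγ)
        rw [h]
        exact Set.mem_univ γ
      · obtain ⟨γ, hγ⟩ := (Set.ne_univ_iff_exists_notMem _).1 h
        exact ⟨_, hγm γ, hγ1 γ, hpeaks γ hγ⟩
    have hnarrow := fun (x y : L1 G₁) (hx : ‖x‖ = 1) (hy : ‖y‖ = 1) (φ : L1 G₁ →L[ℂ] ℂ) (ε : ℝ)
      (hε : 0 < ε) => hT.exists_replacement hγ hγ' hx hy φ hε
    refine ⟨daugavetProperty_of_exists fun x y hx hy φ ε hε => ?_, hnarrow⟩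
    obtain ⟨z, hz1, hz2, hz3⟩ := hnarrow x y hx hy φ ε hε
    exact ⟨z, hz1, (le_add_of_nonneg_left (norm_nonneg _)).trans hz2, hz3⟩
  · refine Set.eq_univ_of_forall fun γ => not_not.1 fun hγ => ?_
    have : DiscreteTopology G₁ := inferInstance
    refine not_hasPeaks_of_measure_singleton_ne_zero (p := 1) (hγm γ) (hγ1 γ) ?_ _ (hpeaks γ hγ)
    exact ((isOpen_discrete {(1 : G₁)}).measure_pos _ (Set.singleton_nonempty _)).ne'
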